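/- Let $k$ be a field, $Q$ a finite quiver, and $I$ an admissible ideal of the path algebra $kQ$ (paths are composed from left to right) such that $A=kQ/I$ is a string presentation, that is: (S1) $I$ is generated by a set of paths; (S2) each point of $Q$ is the source of at most two arrows and the target of at most two arrows; (S3) for each arrow $\alpha$ there is at most one arrow $\beta$ with $\alpha\beta\notin I$ and at most one arrow $\gamma$ with $\gamma\alpha\notin I$. A path is non-zero if it does not lie in $I$; stationary paths are allowed. Modules are right $A$-modules, $P(x)=e_xA$ and $I(x)=D(Ae_x)=\operatorname{Hom}_k(Ae_x,k)$. For a non-zero path $p=[x,y]=\alpha_1\cdots\alpha_t$ from $x$ to $y$, let $M[x,y]$ be the uniserial string module with basis $v_0,\dots,v_t$, where $v_i$ lives at the $i$-th point of $p$, $v_{i-1}\alpha_i=v_i$, and every other product of a basis vector with an arrow is $0$. If $w=p\gamma q$ for an arrow $\gamma$, write $q=w\backslash p$; if $w=p$, then $w\backslash p$ does not exist. A right maximal sequence of a non-zero path $[x_0,y_0]$ is a family of non-zero paths $[x_{0i_2\cdots i_t},y_{0i_2\cdots i_t}]$ with $i_j\in\{0,1\}$, some of which may not exist, that begins with $[x_0,y_0]$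 and satisfies the following. If $q=[x_{0i_2\cdots i_t},y_{0i_2\cdots i_t}]$ exists, let $w_0$ and $w_1$ be the (at most two) maximal non-zero paths starting at $x_{0i_2\cdots i_t}$, named so that $q$ is an initial subpath of $w_0$ (if there is only one, it is $w_0$, and $w_1$ does not exist). Then $$[x_{0i_2\cdots i_t0},y_{0i_2\cdots i_t0}]=w_0\backslash q,\qquad [x_{0i_2\cdots i_t1},y_{0i_2\cdots i_t1}]=w_1\backslash\{x_{0i_2\cdots i_t}\},$$ each existing exactly when its right-hand side exists. If $[x_{0i_2\cdots i_t},y_{0i_2\cdots i_t}]$ does not exist, then neither do $[x_{0i_2\cdots i_ti},y_{0i_2\cdots i_ti}]$ for $i=0,1$. A left maximal sequence $[r_{0i_2\cdots i_t},s_{0i_2\cdots i_t}]$ of a non-zero path $[r_0,s_0]$ is defined dually, with the maximal non-zero paths ending at $s_{0i_2\cdots i_t}$ and with terminal subpaths deleted in place of initial ones. Then: (a) Every non-zero path $[x_0,y_0]$ has a right maximal sequence. For each right maximal sequence of $[x_0,y_0]$ and each minimal projective resolution $$\cdots\to P_2\to P_1\to P_0\to M[x_0,y_0]\to 0,$$ one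 has, for all $l\ge 1$, $$P_{l-1}\cong\bigoplus P(x_{0i_2\cdots i_l}),$$ where the direct sum is over all $l$-tuples $(0,i_2,\dots,i_l)$ with $i_j\in\{0,1\}$ for which the point $x_{0i_2\cdots i_l}$ exists. (b) Every non-zero path $[r_0,s_0]$ has a left maximal sequence. For each left maximal sequence of $[r_0,s_0]$ and each minimal injective coresolution $$0\to M[r_0,s_0]\to I_0\to I_1\to I_2\to\cdots,$$ one has, for all $l\ge 1$, $$I_{l-1}\cong\bigoplus I(s_{0i_2\cdots i_l}),$$ where the direct sum is over all $l$-tuples $(0,i_2,\dots,i_l)$ with $i_j\in\{0,1\}$ for which the point $s_{0i_2\cdots i_l}$ exists. -/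

import Mathlib

open CategoryTheory
open scoped DirectSum MulOpposite

universe u

noncomputable section

namespace StringAlg

/-! ### Paths of a quiver, with varying end points -/

/-- A path of a quiver together with its source and its target. Paths are written from left to
right: `α β` means first `α`, then `β`. Stationary paths are allowed. -/
structure QPath (V : Type u) [Quiver.{u} V] : Type u where
  {src : V}
  {tgt : V}
  path : Quiver.Path src tgt

namespace QPath

variable {V : Type u} [Quiver.{u} V]

/-- The stationary path at `x`. -/
def nil (x : V) : QPath V := ⟨(Quiver.Path.nil : Quiver.Path x x)⟩

/-- The path consisting of one arrow. -/
def arrow {x y : V} (α : x ⟶ y) : QPath V := ⟨α.toPath⟩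

/-- The number of arrows of a path. -/
def length (p : QPath V) : ℕ := p.path.length

open Classical in
/-- The concatenation `p q`, which is defined when `p` ends where `q` starts. -/
def comp? (p q : QPath V) : Option (QPath V) :=
  if h : p.tgt = q.src then some ⟨p.path.comp (q.path.cast h.symm rfl)⟩ else none

theorem comp?_mk {a b c : V} (p : Quiver.Path a b) (q : Quiver.Path b c) :
    comp? ⟨p⟩ ⟨q⟩ = some ⟨p.comp q⟩ := by
  simp [comp?]

theorem comp?_of_ne {p q : QPath V} (h : p.tgt ≠ q.src) : comp? p q = none := by
  simp [comp?, h]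

theorem comp?_nil (p : QPath V) : comp? p (nil p.tgt) = some p := by
  obtain ⟨p⟩ := p
  exact comp?_mk p Quiver.Path.nil

theorem nil_comp? (p : QPath V) : comp? (nil p.src) p = some p := by
  obtain ⟨p⟩ := p
  simpa [nil] using comp?_mk Quiver.Path.nil p

theorem comp?_assoc (p q r : QPath V) :
    (comp? p q).bind (fun u => comp? u r) = (comp? q r).bind (fun u => comp? p u) := by
  obtain @⟨a, b, p⟩ := p
  obtain @⟨c, d, q⟩ := q
  obtain @⟨e, f, r⟩ := r
  by_cases h : b = c
  · subst h
    by_cases h' : d = e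
    · subst h'
      simp [comp?_mk]
    · have h1 : comp? (⟨q⟩ : QPath V) ⟨r⟩ = none := comp?_of_ne h'
      have h2 : comp? (⟨p.comp q⟩ : QPath V) ⟨r⟩ = none := comp?_of_ne h'
      simp [comp?_mk, h1, h2]
  · have h1 : comp? (⟨p⟩ : QPath V) ⟨q⟩ = none := comp?_of_ne h
    by_cases h' : d = e
    · subst h'
      have h2 : comp? (⟨p⟩ : QPath V) ⟨q.comp r⟩ = none := comp?_of_ne h
      simp [comp?_mk, h1, h2]
    · have h3 : comp? (⟨q⟩ : QPath V) ⟨r⟩ = none := comp?_of_ne h'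
      simp [h1, h3]

/-- `u` is an initial subpath of `p`, that is, `p = u r` for some path `r`. -/
def IsPrefix (u p : QPath V) : Prop :=
  ∃ (z : V) (r : Quiver.Path u.tgt z), p = ⟨u.path.comp r⟩

/-- `u` is a terminal subpath of `p`, that is, `p = r u` for some path `r`. -/
def IsSuffix (u p : QPath V) : Prop :=
  ∃ (z : V) (r : Quiver.Path z u.src), p = ⟨r.comp u.path⟩

theorem IsPrefix.of_comp? {u q v p : QPath V} (h : comp? u q = some v) (hv : v.IsPrefix p) :
    u.IsPrefix p := by
  obtain @⟨a, b, u⟩ := u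
  obtain @⟨c, d, q⟩ := q
  by_cases hbc : b = c
  · subst hbc
    rw [comp?_mk] at h
    obtain rfl := Option.some.inj h
    obtain ⟨z, r, rfl⟩ := hv
    exact ⟨z, q.comp r, by simp⟩
  · rw [comp?_of_ne (show (⟨u⟩ : QPath V).tgt ≠ (⟨q⟩ : QPath V).src from hbc)] at h
    cases h

/-- `q` is the path obtained from `w` by deleting the points of its initial subpath `p`:
`w = p γ q` for an arrow `γ`. (If `w = p` then nothing is left, and there is no such `q`.) -/
def IsRightRemainder (p w q : QPath V) : Prop :=
  ∃ γ : p.tgt ⟶ q.src, w = ⟨p.path.comp (γ.toPath.comp q.path)⟩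

/-- `q` is the path obtained from `w` by deleting the points of its terminal subpath `p`:
`w = q γ p` for an arrow `γ`. (If `w = p` then nothing is left, and there is no such `q`.) -/
def IsLeftRemainder (p w q : QPath V) : Prop :=
  ∃ γ : q.tgt ⟶ p.src, w = ⟨q.path.comp (γ.toPath.comp p.path)⟩

end QPath

/-! ### The path algebra -/

/-- The path algebra `kQ`: the vector space with basis the paths of `Q`, multiplied by
concatenation of paths (and by `0` for paths that cannot be concatenated). -/
def PathAlgebra (k V : Type u) [Field k] [Quiver.{u} V] : Type u := QPath V →₀ k

namespace PathAlgebra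

variable (k : Type u) {V : Type u} [Field k] [Quiver.{u} V]

instance : AddCommGroup (PathAlgebra k V) := inferInstanceAs (AddCommGroup (QPath V →₀ k))
instance : Module k (PathAlgebra k V) := inferInstanceAs (Module k (QPath V →₀ k))

/-- A path as an element of the path algebra. -/
def ofPath (p : QPath V) : PathAlgebra k V := Finsupp.single p (1 : k)

/-- A path or zero. -/
def ofOption : Option (QPath V) → PathAlgebra k V
  | none => 0
  | some p => ofPath k p

/-- The linear map on `kQ` with prescribed values on the paths. -/
def lift {M : Type u} [AddCommMonoid M] [Module k M] (f : QPath V → M) : PathAlgebra k V →ₗ[k] M :=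
  Finsupp.linearCombination k f

variable {k}

@[simp] theorem lift_ofPath {M : Type u} [AddCommMonoid M] [Module k M] (f : QPath V → M)
    (p : QPath V) : lift k f (ofPath k p) = f p := by
  exact (Finsupp.linearCombination_single k 1 p).trans (one_smul k (f p))

theorem hom_ext {M : Type u} [AddCommMonoid M] [Module k M] {f g : PathAlgebra k V →ₗ[k] M}
    (h : ∀ p, f (ofPath k p) = g (ofPath k p)) : f = g :=
  Finsupp.lhom_ext' fun p => LinearMap.ext_ring (h p)

variable (k V) in
/-- The multiplication as a bilinear map. -/
def mulMap : PathAlgebra k V →ₗ[k] PathAlgebra k V →ₗ[k] PathAlgebra k V :=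
  lift k fun p => lift k fun q => ofOption k (p.comp? q)

theorem mulMap_ofPath (p q : QPath V) :
    mulMap k V (ofPath k p) (ofPath k q) = ofOption k (p.comp? q) := by
  simp [mulMap]

theorem mulMap_ofOption_left (o : Option (QPath V)) (r : QPath V) :
    mulMap k V (ofOption k o) (ofPath k r) = ofOption k (o.bind fun u => u.comp? r) := by
  cases o <;> simp [ofOption, mulMap_ofPath]

theorem mulMap_ofOption_right (o : Option (QPath V)) (p : QPath V) :
    mulMap k V (ofPath k p) (ofOption k o) = ofOption k (o.bind fun u => p.comp? u) := by
  cases o <;> simp [ofOption, mulMap_ofPath]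

theorem mulMap_assoc (a b c : PathAlgebra k V) :
    mulMap k V (mulMap k V a b) c = mulMap k V a (mulMap k V b c) := by
  have key : (LinearMap.llcomp k _ _ _ (mulMap k V)).comp (mulMap k V)
      = (LinearMap.lcomp k _ (mulMap k V)).comp
          ((LinearMap.llcomp k (PathAlgebra k V) (PathAlgebra k V) (PathAlgebra k V)).comp
            (mulMap k V)) := by
    refine hom_ext fun p => hom_ext fun q => hom_ext fun r => ?_
    simp only [LinearMap.comp_apply, LinearMap.llcomp_apply, LinearMap.lcomp_apply,
      mulMap_ofPath, mulMap_ofOption_left, mulMap_ofOption_right, QPath.comp?_assoc]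
  exact congrArg (fun F => F a b c) key

variable [Fintype V]

variable (k V) in
/-- The unit of the path algebra: the sum of the stationary paths. -/
def one : PathAlgebra k V := ∑ x : V, ofPath k (QPath.nil x)

theorem one_mulMap (a : PathAlgebra k V) : mulMap k V (one k V) a = a := by
  have key : mulMap k V (one k V) = LinearMap.id := by
    refine hom_ext fun p => ?_
    rw [one, map_sum, LinearMap.sum_apply, Finset.sum_eq_single p.src]
    · simp [mulMap_ofPath, QPath.nil_comp?, ofOption]
    · intro x _ hx
      rw [mulMap_ofPath, QPath.comp?_of_ne (show (QPath.nil x).tgt ≠ p.src from hx), ofOption]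
    · simp
  exact congrArg (fun F => F a) key

theorem mulMap_one (a : PathAlgebra k V) : mulMap k V a (one k V) = a := by
  have key : (mulMap k V).flip (one k V) = LinearMap.id := by
    refine hom_ext fun p => ?_
    rw [one, map_sum, LinearMap.sum_apply, Finset.sum_eq_single p.tgt]
    · simp [mulMap_ofPath, QPath.comp?_nil, ofOption]
    · intro x _ hx
      rw [LinearMap.flip_apply, mulMap_ofPath,
        QPath.comp?_of_ne (show p.tgt ≠ (QPath.nil x).src from Ne.symm hx), ofOption]
    · simp
  exact congrArg (fun F => F a) key

instance : Ring (PathAlgebra k V) :=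
  { (inferInstance : AddCommGroup (PathAlgebra k V)) with
    mul := fun a b => mulMap k V a b
    one := one k V
    left_distrib := fun a b c => map_add (mulMap k V a) b c
    right_distrib := fun a b c => LinearMap.map_add₂ (mulMap k V) a b c
    zero_mul := fun a => LinearMap.map_zero₂ (mulMap k V) a
    mul_zero := fun a => map_zero (mulMap k V a)
    mul_assoc := mulMap_assoc
    one_mul := one_mulMap
    mul_one := mulMap_one }

instance : Algebra k (PathAlgebra k V) :=
  Algebra.ofModule
    (fun r a b => LinearMap.map_smul₂ (mulMap k V) r a b)
    (fun r a b => map_smul (mulMap k V a) r b)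

theorem mul_def (a b : PathAlgebra k V) : a * b = mulMap k V a b := rfl

theorem ofPath_mul_ofPath (p q : QPath V) :
    ofPath k p * ofPath k q = ofOption k (p.comp? q) := mulMap_ofPath p q

end PathAlgebra

/-! ### String algebras -/

variable {k V : Type u} [Field k] [Quiver.{u} V] [Fintype V]

/-- The `m`-th power `R^m` of the two-sided ideal `R` of `kQ` generated by the arrows: it is the
two-sided ideal generated by the paths of length `m`. -/
def arrowIdealPow (k V : Type u) [Field k] [Quiver.{u} V] [Fintype V] (m : ℕ) :
    TwoSidedIdeal (PathAlgebra k V) :=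
  TwoSidedIdeal.span {a | ∃ p : QPath V, p.length = m ∧ a = PathAlgebra.ofPath k p}

/-- A two-sided ideal `I` of `kQ` is admissible if `R^m ⊆ I ⊆ R^2` for some `m ≥ 2`. -/
def IsAdmissible (I : TwoSidedIdeal (PathAlgebra k V)) : Prop :=
  (∃ m : ℕ, 2 ≤ m ∧ arrowIdealPow k V m ≤ I) ∧ I ≤ arrowIdealPow k V 2

/-- `I` is generated, as a two-sided ideal, by a set of paths. -/
def IsMonomial (I : TwoSidedIdeal (PathAlgebra k V)) : Prop :=
  ∃ S : Set (QPath V), I = TwoSidedIdeal.span (PathAlgebra.ofPath k '' S)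

/-- The path `p` is non-zero in `kQ/I`. -/
def IsNonzeroPath (I : TwoSidedIdeal (PathAlgebra k V)) (p : QPath V) : Prop :=
  PathAlgebra.ofPath k p ∉ I

/-- `kQ/I` is a string presentation (`Q` is a finite quiver with set of points `V`). -/
structure IsStringPresentation (I : TwoSidedIdeal (PathAlgebra k V)) : Prop where
  admissible : IsAdmissible I
  monomial : IsMonomial I
  /-- Each point is the source of at most two arrows. -/
  source_le_two : ∀ x : V, ENat.card (Σ y : V, (x ⟶ y)) ≤ 2
  /-- Each point is the target of at most two arrows. -/
  target_le_two : ∀ x : V, ENat.card (Σ y : V, (y ⟶ x)) ≤ 2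
  /-- For an arrow `α` there is at most one arrow `β` with `α β ∉ I`. -/
  right_unique : ∀ {x y : V} (α : x ⟶ y),
    {β : Σ z : V, (y ⟶ z) | IsNonzeroPath I ⟨α.toPath.comp β.2.toPath⟩}.Subsingleton
  /-- For an arrow `α` there is at most one arrow `γ` with `γ α ∉ I`. -/
  left_unique : ∀ {x y : V} (α : x ⟶ y),
    {γ : Σ z : V, (z ⟶ x) | IsNonzeroPath I ⟨γ.2.toPath.comp α.toPath⟩}.Subsingleton

/-- The bound quiver algebra `A = kQ/I`. Right `A`-modules are modules over `Aᵐᵒᵖ`. -/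
abbrev BoundAlg (I : TwoSidedIdeal (PathAlgebra k V)) : Type u := I.ringCon.Quotient

/-- The primitive idempotent `e_x` of `A = kQ/I`. -/
def idem (I : TwoSidedIdeal (PathAlgebra k V)) (x : V) : BoundAlg I :=
  I.ringCon.mk' (PathAlgebra.ofPath k (QPath.nil x))

/-- The indecomposable projective right `A`-module `P(x) = e_x A`. -/
abbrev ProjAt (I : TwoSidedIdeal (PathAlgebra k V)) (x : V) : Type u :=
  (Submodule.span (BoundAlg I)ᵐᵒᵖ {idem I x} : Submodule (BoundAlg I)ᵐᵒᵖ (BoundAlg I))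

/-- The left `A`-module `A e_x`. -/
abbrev LeftProjAt (I : TwoSidedIdeal (PathAlgebra k V)) (x : V) : Type u :=
  (Submodule.span (BoundAlg I) {idem I x} : Submodule (BoundAlg I) (BoundAlg I))

/-- The indecomposable injective right `A`-module `I(x) = D(A e_x) = Hom_k(A e_x, k)`. -/
def InjAt (I : TwoSidedIdeal (PathAlgebra k V)) (x : V) : Type u := LeftProjAt I x →ₗ[k] k

instance (I : TwoSidedIdeal (PathAlgebra k V)) (x : V) : AddCommGroup (InjAt I x) :=
  inferInstanceAs (AddCommGroup (LeftProjAt I x →ₗ[k] k))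

/-- The right action of `A` on `D(A e_x)`: `(f a)(b) = f (a b)`. -/
instance (I : TwoSidedIdeal (PathAlgebra k V)) (x : V) : Module (BoundAlg I)ᵐᵒᵖ (InjAt I x) where
  smul a f := LinearMap.comp (show LeftProjAt I x →ₗ[k] k from f)
    (Algebra.lsmul k k (LeftProjAt I x) a.unop)
  one_smul f := LinearMap.ext fun b =>
    congrArg (show LeftProjAt I x →ₗ[k] k from f) (one_smul (BoundAlg I) b)
  mul_smul a a' f := LinearMap.ext fun b =>
    congrArg (show LeftProjAt I x →ₗ[k] k from f) (mul_smul a'.unop a.unop b)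
  smul_zero _ := LinearMap.zero_comp _
  smul_add _ _ _ := LinearMap.add_comp _ _ _
  add_smul a a' f := LinearMap.ext fun b =>
    (congrArg (show LeftProjAt I x →ₗ[k] k from f) (add_smul a.unop a'.unop b)).trans
      (map_add (show LeftProjAt I x →ₗ[k] k from f) _ _)
  zero_smul f := LinearMap.ext fun b =>
    (congrArg (show LeftProjAt I x →ₗ[k] k from f) (zero_smul (BoundAlg I) b)).trans
      (map_zero (show LeftProjAt I x →ₗ[k] k from f))

/-! ### The uniserial string module of a non-zero path -/

/-- The underlying vector space of the string module of a path `p = α_1 ⋯ α_t`: it has one basis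
vector `v_i` for each of the `t + 1` points through which `p` passes. We index the basis by the
initial subpaths of `p`; the initial subpath `α_1 ⋯ α_i` stands for the `i`-th point, and
`v_i` lives at its target. -/
abbrev PathSpace (k : Type u) {V : Type u} [Field k] [Quiver.{u} V] (p : QPath V) : Type u :=
  {w : QPath V // w.IsPrefix p} →₀ k

namespace PathSpace

open Classical in
/-- The basis vector belonging to `w` if `w` is an initial subpath of `p`, and `0` otherwise. -/
def vec (k : Type u) {V : Type u} [Field k] [Quiver.{u} V] (p : QPath V) :
    Option (QPath V) → PathSpace k p
  | none => 0
  | some w => if h : w.IsPrefix p then Finsupp.single ⟨w, h⟩ 1 else 0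

/-- The action from the right of a path `q`: it sends the basis vector of the initial subpath `w`
to that of `w q` if this is again an initial subpath of `p`, and to `0` otherwise. In particular
`e_x` is the projection onto the basis vectors that live at `x`, and the arrow `α` sends
`v_{i-1}` to `v_i` if `α = α_i`, and to `0` otherwise. -/
def act (k : Type u) {V : Type u} [Field k] [Quiver.{u} V] (p q : QPath V) :
    Module.End k (PathSpace k p) :=
  Finsupp.linearCombination k fun w : {w : QPath V // w.IsPrefix p} => vec k p (w.1.comp? q)


theorem act_single {k V : Type u} [Field k] [Quiver.{u} V] {p : QPath V} (q : QPath V)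
    (w : {w : QPath V // w.IsPrefix p}) :
    act k p q (Finsupp.single w 1) = vec k p (w.1.comp? q) := by
  simp [act]

theorem act_vec {k V : Type u} [Field k] [Quiver.{u} V] {p : QPath V} (q : QPath V)
    (o : Option (QPath V)) :
    act k p q (vec k p o) = vec k p (o.bind fun w => w.comp? q) := by
  cases o with
  | none => simp [vec]
  | some w =>
    by_cases h : w.IsPrefix p
    · simp [vec, h, act_single]
    · simp only [vec, h, dite_false, map_zero, Option.bind_some]
      cases hc : w.comp? q with
      | none => rfl
      | some v =>
        have hv : ¬ v.IsPrefix p := fun hv => h (QPath.IsPrefix.of_comp? hc hv)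
        simp [hv]

/-- The right action of `kQ`, as a linear map to the opposite endomorphism algebra. -/
def actLinear (k : Type u) {V : Type u} [Field k] [Quiver.{u} V] (p : QPath V) :
    PathAlgebra k V →ₗ[k] (Module.End k (PathSpace k p))ᵐᵒᵖ :=
  PathAlgebra.lift k fun q => MulOpposite.op (act k p q)

theorem actLinear_ofOption {k V : Type u} [Field k] [Quiver.{u} V] {p : QPath V}
    (o : Option (QPath V)) (w : {w : QPath V // w.IsPrefix p}) :
    (actLinear k p (PathAlgebra.ofOption k o)).unop (Finsupp.single w 1)
      = vec k p (o.bind fun q => w.1.comp? q) := by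
  cases o with
  | none => simp [PathAlgebra.ofOption, vec]
  | some q => simp [PathAlgebra.ofOption, actLinear, act_single]

theorem actLinear_mul (p : QPath V) (a b : PathAlgebra k V) :
    actLinear k p (a * b) = actLinear k p a * actLinear k p b := by
  have key : (LinearMap.llcomp k (PathAlgebra k V) (PathAlgebra k V)
      (Module.End k (PathSpace k p))ᵐᵒᵖ (actLinear k p)).comp (PathAlgebra.mulMap k V)
      = (LinearMap.lcomp k (Module.End k (PathSpace k p))ᵐᵒᵖ (actLinear k p)).comp
          ((LinearMap.mul k (Module.End k (PathSpace k p))ᵐᵒᵖ).comp (actLinear k p)) := by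
    refine PathAlgebra.hom_ext fun q => PathAlgebra.hom_ext fun r => ?_
    apply MulOpposite.unop_injective
    refine Finsupp.lhom_ext' fun w => LinearMap.ext_ring ?_
    simp only [LinearMap.comp_apply, LinearMap.llcomp_apply, LinearMap.lcomp_apply,
      PathAlgebra.mulMap_ofPath, Finsupp.lsingle_apply, actLinear_ofOption,
      LinearMap.mul_apply', MulOpposite.unop_mul, Module.End.mul_apply]
    simp [actLinear, act_single, act_vec, QPath.comp?_assoc]
  exact congrArg (fun F => F a b) key

theorem actLinear_one (p : QPath V) : actLinear k p 1 = 1 := by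
  have h1 : (1 : PathAlgebra k V) = ∑ x : V, PathAlgebra.ofPath k (QPath.nil x) := rfl
  have h2 : actLinear k p 1 = MulOpposite.op (∑ x : V, act k p (QPath.nil x)) := by
    simp [h1, actLinear]
  rw [h2]
  apply MulOpposite.unop_injective
  refine Finsupp.lhom_ext' fun w => LinearMap.ext_ring ?_
  rw [MulOpposite.unop_op, LinearMap.comp_apply, LinearMap.comp_apply, Finsupp.lsingle_apply,
    LinearMap.sum_apply, Finset.sum_eq_single w.1.tgt]
  · simp [act_single, QPath.comp?_nil, vec, w.2]
  · intro x _ hx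
    simp [act_single, vec,
      QPath.comp?_of_ne (show w.1.tgt ≠ (QPath.nil x).src from Ne.symm hx)]
  · simp

/-- The right action of `kQ`, as a ring homomorphism to the opposite endomorphism algebra. -/
def actHom (k : Type u) {V : Type u} [Field k] [Quiver.{u} V] [Fintype V] (p : QPath V) :
    PathAlgebra k V →+* (Module.End k (PathSpace k p))ᵐᵒᵖ where
  toFun := actLinear k p
  map_one' := actLinear_one p
  map_mul' := actLinear_mul p
  map_zero' := map_zero _
  map_add' := map_add _

/-- If `I` is generated by paths and `p` is non-zero, then `I` acts by zero. -/
theorem le_ker {I : TwoSidedIdeal (PathAlgebra k V)} (hI : IsMonomial I) {p : QPath V}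
    (hp : IsNonzeroPath I p) : I ≤ TwoSidedIdeal.ker (actHom k p) := by
  obtain ⟨S, rfl⟩ := hI
  rw [TwoSidedIdeal.span_le]
  rintro _ ⟨q, hq, rfl⟩
  have hqI := TwoSidedIdeal.subset_span (Set.mem_image_of_mem (PathAlgebra.ofPath k) hq)
  rw [SetLike.mem_coe, TwoSidedIdeal.mem_ker]
  apply MulOpposite.unop_injective
  refine Finsupp.lhom_ext' fun w => LinearMap.ext_ring ?_
  have : (actHom k p (PathAlgebra.ofPath k q)).unop (Finsupp.single w 1)
      = vec k p (w.1.comp? q) := by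
    simp [actHom, actLinear, act_single]
  rw [LinearMap.comp_apply, Finsupp.lsingle_apply, this]
  cases hc : w.1.comp? q with
  | none => simp [vec]
  | some v =>
    by_cases hv : v.IsPrefix p
    · exfalso
      apply hp
      obtain ⟨z, r, rfl⟩ := hv
      have h1 := TwoSidedIdeal.mul_mem_right _ _ (PathAlgebra.ofPath k (⟨r⟩ : QPath V))
        (TwoSidedIdeal.mul_mem_left _ (PathAlgebra.ofPath k w.1) _ hqI)
      rw [PathAlgebra.ofPath_mul_ofPath, hc] at h1
      simp only [PathAlgebra.ofOption] at h1
      rw [PathAlgebra.ofPath_mul_ofPath, QPath.comp?_mk v.path r] at h1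
      exact h1
    · simp [vec, hv]

end PathSpace

/-- The uniserial string module `M(p)` over `A = kQ/I` of a path `p` that is non-zero in `A`. -/
def PathModule {I : TwoSidedIdeal (PathAlgebra k V)} (_hI : IsMonomial I) {p : QPath V}
    (_hp : IsNonzeroPath I p) : Type u := PathSpace k p

section PathModule

variable {I : TwoSidedIdeal (PathAlgebra k V)} (hI : IsMonomial I) {p : QPath V}
  (hp : IsNonzeroPath I p)

instance : AddCommGroup (PathModule hI hp) := inferInstanceAs (AddCommGroup (PathSpace k p))

/-- The right action of `A = kQ/I` on `M(p)`, induced by the action of `kQ`. -/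
def pathModuleHom : BoundAlg I →+* (Module.End k (PathSpace k p))ᵐᵒᵖ :=
  I.ringCon.lift (PathSpace.actHom k p) (TwoSidedIdeal.ringCon_le_iff.mp (PathSpace.le_ker hI hp))

instance : Module (BoundAlg I)ᵐᵒᵖ (PathModule hI hp) where
  smul a m := (pathModuleHom hI hp a.unop).unop (show PathSpace k p from m)
  one_smul m := by
    change (pathModuleHom hI hp 1).unop (show PathSpace k p from m) = m
    rw [map_one]; rfl
  mul_smul a b m := by
    change (pathModuleHom hI hp (b.unop * a.unop)).unop (show PathSpace k p from m) = _
    rw [map_mul]; rfl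
  smul_zero a := map_zero (pathModuleHom hI hp a.unop).unop
  smul_add a := map_add (pathModuleHom hI hp a.unop).unop
  add_smul a b m := by
    change (pathModuleHom hI hp (a.unop + b.unop)).unop (show PathSpace k p from m) = _
    rw [map_add]; rfl
  zero_smul m := by
    change (pathModuleHom hI hp 0).unop (show PathSpace k p from m) = _
    rw [map_zero]; rfl

end PathModule

/-! ### Right and left maximal sequences -/

section MaximalSequences

variable (I : TwoSidedIdeal (PathAlgebra k V))

/-- `w` is a maximal non-zero path among those starting at the point `x`. -/
def IsMaximalFrom (x : V) (w : QPath V) : Prop :=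
  w.src = x ∧ IsNonzeroPath I w ∧
    ∀ (z : V) (γ : w.tgt ⟶ z), ¬ IsNonzeroPath I ⟨w.path.comp γ.toPath⟩

/-- `w` is a maximal non-zero path among those ending at the point `x`. -/
def IsMaximalTo (x : V) (w : QPath V) : Prop :=
  w.tgt = x ∧ IsNonzeroPath I w ∧
    ∀ (z : V) (γ : z ⟶ w.src), ¬ IsNonzeroPath I ⟨γ.toPath.comp w.path⟩

/-- `w₀` and `w₁` are the maximal non-zero paths starting at the source of `p`, where `p` is
contained in `w₀`. If there is only one such maximal path, then it is `w₀`, and `w₁` does not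
exist. -/
structure IsRightMaximalPair (p w₀ : QPath V) (w₁ : Option (QPath V)) : Prop where
  isPrefix : p.IsPrefix w₀
  ne : w₁ ≠ some w₀
  iff_maximal : ∀ w : QPath V, IsMaximalFrom I p.src w ↔ (w = w₀ ∨ w₁ = some w)

/-- `w₀` and `w₁` are the maximal non-zero paths ending at the target of `p`, where `p` is
contained in `w₀`. If there is only one such maximal path, then it is `w₀`, and `w₁` does not
exist. -/
structure IsLeftMaximalPair (p w₀ : QPath V) (w₁ : Option (QPath V)) : Prop where
  isSuffix : p.IsSuffix w₀
  ne : w₁ ≠ some w₀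
  iff_maximal : ∀ w : QPath V, IsMaximalTo I p.tgt w ↔ (w = w₀ ∨ w₁ = some w)

/-- `s` is a right maximal sequence of the path `p`. The value `s [i_2, …, i_t]` is the path
`[x_{0 i_2 ⋯ i_t}, y_{0 i_2 ⋯ i_t}]`, or `none` if this path does not exist. If `q = s t` exists
and `w₀`, `w₁` are the maximal non-zero paths starting at the source of `q`, with `q` contained in
`w₀`, then `s (t ++ [0])` is `w₀` without the points of `q`, and `s (t ++ [1])` is `w₁` without
its starting point. -/
structure IsRightMaximalSequence (p : QPath V) (s : List (Fin 2) → Option (QPath V)) : Prop where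
  start : s [] = some p
  of_none : ∀ t, s t = none → ∀ i : Fin 2, s (t ++ [i]) = none
  step : ∀ t q, s t = some q → ∃ w₀ w₁, IsRightMaximalPair I q w₀ w₁ ∧
    (∀ q', s (t ++ [0]) = some q' ↔ q.IsRightRemainder w₀ q') ∧
    (∀ q', s (t ++ [1]) = some q' ↔
      ∃ w, w₁ = some w ∧ (QPath.nil q.src).IsRightRemainder w q')

/-- `s` is a left maximal sequence of the path `p`. The value `s [i_2, …, i_t]` is the path
`[r_{0 i_2 ⋯ i_t}, s_{0 i_2 ⋯ i_t}]`, or `none` if this path does not exist. If `q = s t` exists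
and `w₀`, `w₁` are the maximal non-zero paths ending at the target of `q`, with `q` contained in
`w₀`, then `s (t ++ [0])` is `w₀` without the points of `q`, and `s (t ++ [1])` is `w₁` without
its end point. -/
structure IsLeftMaximalSequence (p : QPath V) (s : List (Fin 2) → Option (QPath V)) : Prop where
  start : s [] = some p
  of_none : ∀ t, s t = none → ∀ i : Fin 2, s (t ++ [i]) = none
  step : ∀ t q, s t = some q → ∃ w₀ w₁, IsLeftMaximalPair I q w₀ w₁ ∧
    (∀ q', s (t ++ [0]) = some q' ↔ q.IsLeftRemainder w₀ q') ∧
    (∀ q', s (t ++ [1]) = some q' ↔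
      ∃ w, w₁ = some w ∧ (QPath.nil q.tgt).IsLeftRemainder w q')

end MaximalSequences

/-- The tuples `(0, i_2, …, i_l)` for which the path `s [i_2, …, i_l]` exists. -/
abbrev ExistingTuples (s : List (Fin 2) → Option (QPath V)) (l : ℕ) : Type :=
  {t : List (Fin 2) // t.length + 1 = l ∧ (s t).isSome}

/-- The path `s [i_2, …, i_l]` belonging to a tuple for which it exists. -/
def ExistingTuples.path {s : List (Fin 2) → Option (QPath V)} {l : ℕ} (t : ExistingTuples s l) :
    QPath V := (s t.1).get t.2.2

/-! ### Minimal resolutions -/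

/-- A submodule `N` of `M` is superfluous if `N + L = M` implies `L = M`. -/
def IsSuperfluous {R M : Type u} [Ring R] [AddCommGroup M] [Module R M] (N : Submodule R M) :
    Prop := ∀ L : Submodule R M, N ⊔ L = ⊤ → L = ⊤

/-- A submodule `N` of `M` is essential if `N ∩ L = 0` implies `L = 0`. -/
def IsEssential {R M : Type u} [Ring R] [AddCommGroup M] [Module R M] (N : Submodule R M) :
    Prop := ∀ L : Submodule R M, N ⊓ L = ⊥ → L = ⊥

/-- A projective resolution `⋯ → P_1 → P_0 → M → 0` is minimal if each of the maps `P_0 → M`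
and `P_{n+1} → Im (P_{n+1} → P_n)` is a projective cover, that is, has a superfluous kernel. -/
def IsMinimalProjectiveResolution {R : Type u} [Ring R] {M : ModuleCat.{u} R}
    (P : ProjectiveResolution M) : Prop :=
  IsSuperfluous (LinearMap.ker (P.π.f 0).hom) ∧
    ∀ n : ℕ, IsSuperfluous (LinearMap.ker (P.complex.d (n + 1) n).hom)

/-- An injective coresolution `0 → M → I_0 → I_1 → ⋯` is minimal if each of the maps `M → I_0`
and `Im (I_n → I_{n+1}) → I_{n+1}` is an injective envelope, that is, has an essential image. -/
def IsMinimalInjectiveResolution {R : Type u} [Ring R] {M : ModuleCat.{u} R}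
    (J : InjectiveResolution M) : Prop :=
  IsEssential (LinearMap.range (J.ι.f 0).hom) ∧
    ∀ n : ℕ, IsEssential (LinearMap.range (J.cocomplex.d n (n + 1)).hom)

end StringAlg

end

open StringAlg

/-!
A minimal projective resolution is built from projective covers of successive syzygies, and projective
covers are unique. So it suffices to exhibit, for every tuple of a right maximal sequence, the
projective cover of the string module of its path `q`, and to identify the kernel with the direct sum
of the string modules of the successors of `q` in the sequence. This comparison is
`nonempty_equiv_of_projectiveCovers`; its dual is `nonempty_equiv_of_injectiveEnvelopes`.

Let `x` be the source of `q`. Since `I` is generated by paths, `P(x)` has a basis consisting of the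
non-zero paths starting at `x`, and `P(x) → M(q)` sends the initial subpaths of `q` to the basis of
`M(q)` and all other paths to zero. The paths that are killed are classified by the combinatorial
heart of the argument, `IsStringLike.exists_isBranching`: in a string presentation a non-stationary
non-zero path has at most one continuation by an arrow, so each such path extends either `q` by an
arrow inside `w₀`, or the first arrow of `w₁`, and the rest is an initial subpath of the respective
successor. Multiplication on the left therefore identifies the kernel with the direct sum of the
string modules of the successors (`range_kernelInclusion`). The kernel lies in the radical, which is
nilpotent, hence it is superfluous (`isSuperfluous_of_le_radPow`).

Dually, if `q` ends at `x`, then `I(x)` consists of the functions on the non-zero paths ending at `x`,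
the image of `M(q)` consists of those supported on the terminal subpaths of `q`, and the values at
the other paths describe elements of the string modules of the successors
(`range_injEnvelope_eq_ker`). The image of `M(q)` contains the socle of `I(x)`, so it is essential
(`isEssential_of_socle_le`).

The two sides of the combinatorics are treated at once, as statements about a concatenation `m` of
paths which is either `comp?` or `flip comp?`.
-/

noncomputable section

namespace StringAlg

/-! ### Uniqueness of minimal resolutions -/

section MinimalResolutions

variable {R : Type u} [Ring R]

/-- Projective covers are unique: two projective modules that cover the same module with
superfluous kernels are isomorphic over it. -/
theorem exists_equiv_of_isSuperfluous_ker {P P' K : Type u} [AddCommGroup P] [Module R P]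
    [AddCommGroup P'] [Module R P'] [AddCommGroup K] [Module R K]
    [Module.Projective R P] [Module.Projective R P'] {f : P →ₗ[R] K} {f' : P' →ₗ[R] K}
    (hf : Function.Surjective f) (hf' : Function.Surjective f')
    (hs : IsSuperfluous (LinearMap.ker f)) (hs' : IsSuperfluous (LinearMap.ker f')) :
    ∃ h : P ≃ₗ[R] P', ∀ x, f' (h x) = f x := by
  obtain ⟨h, hh⟩ := Module.projective_lifting_property f' f hf'
  have hh' : ∀ x, f' (h x) = f x := fun x => LinearMap.congr_fun hh x
  have hsurj : Function.Surjective h := by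
    refine LinearMap.range_eq_top.mp (hs' _ (eq_top_iff.mpr fun y _ => ?_))
    obtain ⟨x, hx⟩ := hf (f' y)
    refine Submodule.mem_sup.mpr ⟨y - h x, ?_, h x, ⟨x, rfl⟩, sub_add_cancel _ _⟩
    rw [LinearMap.mem_ker, map_sub, hh', hx, sub_self]
  -- `h` splits, and the image of a section is all of `P` because `ker h ≤ ker f` is superfluous.
  obtain ⟨g, hg⟩ := Module.projective_lifting_property h LinearMap.id hsurj
  have hg' : ∀ y, h (g y) = y := fun y => LinearMap.congr_fun hg y
  have gsurj : Function.Surjective g := by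
    refine LinearMap.range_eq_top.mp (hs _ (eq_top_iff.mpr fun x _ => ?_))
    refine Submodule.mem_sup.mpr ⟨x - g (h x), ?_, g (h x), ⟨h x, rfl⟩, sub_add_cancel _ _⟩
    rw [LinearMap.mem_ker, map_sub, ← hh' (g (h x)), hg', hh', sub_self]
  refine ⟨LinearEquiv.ofBijective h ⟨fun x x' hx => ?_, hsurj⟩, hh'⟩
  obtain ⟨y, rfl⟩ := gsurj x
  obtain ⟨y', rfl⟩ := gsurj x'
  rw [hg', hg'] at hx
  rw [hx]

/-- Injective envelopes are unique: two injective modules that contain the same module with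
essential images are isomorphic under it. -/
theorem exists_equiv_of_isEssential_range {E E' K : Type u} [AddCommGroup E] [Module R E]
    [AddCommGroup E'] [Module R E'] [AddCommGroup K] [Module R K]
    [Module.Injective R E] [Module.Injective R E'] {f : K →ₗ[R] E} {f' : K →ₗ[R] E'}
    (hf : Function.Injective f) (hf' : Function.Injective f')
    (hs : IsEssential (LinearMap.range f)) (hs' : IsEssential (LinearMap.range f')) :
    ∃ h : E ≃ₗ[R] E', ∀ x, h (f x) = f' x := by
  obtain ⟨h, hh⟩ := Module.Injective.out f hf f'
  have hinj : Function.Injective h := by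
    refine LinearMap.ker_eq_bot.mp (hs _ (eq_bot_iff.mpr ?_))
    rintro _ ⟨⟨x, rfl⟩, hx⟩
    have : f' x = 0 := by rw [← hh]; exact hx
    rw [(map_eq_zero_iff f' hf').mp this, map_zero]
    exact Submodule.zero_mem _
  -- `h` splits, and the retraction is injective because it is so on `range f'`.
  obtain ⟨g, hg⟩ := Module.Injective.out h hinj LinearMap.id
  have hg' : ∀ y, g (h y) = y := hg
  have ginj : Function.Injective g := by
    refine LinearMap.ker_eq_bot.mp (hs' _ (eq_bot_iff.mpr ?_))
    rintro _ ⟨⟨x, rfl⟩, hx⟩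
    have : f x = 0 := by rw [← hg' (f x), hh]; exact hx
    rw [(map_eq_zero_iff f hf).mp this, map_zero]
    exact Submodule.zero_mem _
  exact ⟨LinearEquiv.ofBijective h ⟨hinj, fun y => ⟨g y, ginj (hg' _)⟩⟩, hh⟩

/-- The terms of a minimal projective resolution `P` of `T 0` are determined by any sequence of
projective covers `ρ n : S n → T n` in which `T (n + 1)` is isomorphic to the kernel of `ρ n`.
The submodule `K n` is the `n`-th syzygy inside `P n`. -/
theorem nonempty_equiv_of_projectiveCovers {P T S : ℕ → Type u}
    [∀ n, AddCommGroup (P n)] [∀ n, Module R (P n)] [∀ n, AddCommGroup (T n)]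
    [∀ n, Module R (T n)] [∀ n, AddCommGroup (S n)] [∀ n, Module R (S n)]
    [∀ n, Module.Projective R (P n)] [∀ n, Module.Projective R (S n)]
    {d : ∀ n, P (n + 1) →ₗ[R] P n} {π : P 0 →ₗ[R] T 0} {K : ∀ n, Submodule R (P n)}
    (hπ : Function.Surjective π) (hK₀ : LinearMap.ker π = K 0)
    (hK : ∀ n, LinearMap.ker (d n) = K (n + 1)) (hd : ∀ n, LinearMap.range (d n) = K n)
    (hmin : ∀ n, IsSuperfluous (K n))
    {ρ : ∀ n, S n →ₗ[R] T n} {ι : ∀ n, T (n + 1) →ₗ[R] S n}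
    (hρ : ∀ n, Function.Surjective (ρ n)) (hρs : ∀ n, IsSuperfluous (LinearMap.ker (ρ n)))
    (hι : ∀ n, Function.Injective (ι n))
    (hιρ : ∀ n, LinearMap.range (ι n) = LinearMap.ker (ρ n)) (n : ℕ) :
    Nonempty (P n ≃ₗ[R] S n) := by
  have key : ∀ n, ∃ f : P n →ₗ[R] T n, Function.Surjective f ∧ LinearMap.ker f = K n := by
    intro n
    induction n with
    | zero => exact ⟨π, hπ, hK₀⟩
    | succ n ih =>
      obtain ⟨f, hf, hfK⟩ := ih
      obtain ⟨h, hh⟩ := exists_equiv_of_isSuperfluous_ker hf (hρ n) (hfK ▸ hmin n) (hρs n)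
      have hmem : ∀ x, h (d n x) ∈ LinearMap.range (ι n) := fun x => by
        rw [hιρ, LinearMap.mem_ker, hh, ← LinearMap.mem_ker, hfK, ← hd]
        exact ⟨x, rfl⟩
      let e := LinearEquiv.ofInjective (ι n) (hι n)
      let g : P (n + 1) →ₗ[R] LinearMap.range (ι n) :=
        LinearMap.codRestrict _ (h.toLinearMap ∘ₗ d n) hmem
      have hg : ∀ x, (g x : S n) = h (d n x) := fun x => rfl
      refine ⟨e.symm.toLinearMap ∘ₗ g, fun t => ?_, ?_⟩
      · have ht : h.symm (ι n t) ∈ K n := by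
          rw [← hfK, LinearMap.mem_ker, ← hh, h.apply_symm_apply, ← LinearMap.mem_ker, ← hιρ]
          exact ⟨t, rfl⟩
        rw [← hd] at ht
        obtain ⟨x, hx⟩ := ht
        refine ⟨x, ?_⟩
        rw [LinearMap.comp_apply, LinearEquiv.coe_coe, LinearEquiv.symm_apply_eq]
        apply Subtype.ext
        rw [hg, hx, h.apply_symm_apply]
        rfl
      · rw [← hK]
        ext x
        rw [LinearMap.mem_ker, LinearMap.mem_ker, LinearMap.comp_apply, LinearEquiv.coe_coe,
          LinearEquiv.map_eq_zero_iff, ← Submodule.coe_eq_zero, hg, LinearEquiv.map_eq_zero_iff]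
  obtain ⟨f, hf, hfK⟩ := key n
  obtain ⟨h, -⟩ := exists_equiv_of_isSuperfluous_ker hf (hρ n) (hfK ▸ hmin n) (hρs n)
  exact ⟨h⟩

/-- The terms of a minimal injective coresolution `J` of `T 0` are determined by any sequence of
injective envelopes `ι n : T n → S n` in which `T (n + 1)` is isomorphic to the cokernel of `ι n`.
The submodule `K n` of `J n` is the image of the `n`-th cosyzygy. -/
theorem nonempty_equiv_of_injectiveEnvelopes {J T S : ℕ → Type u}
    [∀ n, AddCommGroup (J n)] [∀ n, Module R (J n)] [∀ n, AddCommGroup (T n)]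
    [∀ n, Module R (T n)] [∀ n, AddCommGroup (S n)] [∀ n, Module R (S n)]
    [∀ n, Module.Injective R (J n)] [∀ n, Module.Injective R (S n)]
    {d : ∀ n, J n →ₗ[R] J (n + 1)} {i : T 0 →ₗ[R] J 0} {K : ∀ n, Submodule R (J n)}
    (hi : Function.Injective i) (hK₀ : LinearMap.range i = K 0)
    (hK : ∀ n, LinearMap.range (d n) = K (n + 1)) (hd : ∀ n, LinearMap.ker (d n) = K n)
    (hmin : ∀ n, IsEssential (K n))
    {ι : ∀ n, T n →ₗ[R] S n} {ρ : ∀ n, S n →ₗ[R] T (n + 1)}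
    (hι : ∀ n, Function.Injective (ι n)) (hιs : ∀ n, IsEssential (LinearMap.range (ι n)))
    (hρ : ∀ n, Function.Surjective (ρ n))
    (hιρ : ∀ n, LinearMap.range (ι n) = LinearMap.ker (ρ n)) (n : ℕ) :
    Nonempty (J n ≃ₗ[R] S n) := by
  have key : ∀ n, ∃ f : T n →ₗ[R] J n, Function.Injective f ∧ LinearMap.range f = K n := by
    intro n
    induction n with
    | zero => exact ⟨i, hi, hK₀⟩
    | succ n ih =>
      obtain ⟨f, hf, hfK⟩ := ih
      obtain ⟨h, hh⟩ := exists_equiv_of_isEssential_range hf (hι n) (hfK ▸ hmin n) (hιs n)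
      have hker : ∀ x, ρ n (h x) = 0 ↔ d n x = 0 := fun x => by
        rw [← LinearMap.mem_ker, ← LinearMap.mem_ker, ← hιρ, hd, ← hfK]
        constructor
        · rintro ⟨t, ht⟩
          exact ⟨t, h.injective (by rw [hh, ht])⟩
        · rintro ⟨t, rfl⟩
          exact ⟨t, (hh t).symm⟩
      -- Both `d n` and `ρ n ∘ h` have the kernel `K n`, so the images are isomorphic.
      let e := (ρ n ∘ₗ h.toLinearMap).quotKerEquivOfSurjective ((hρ n).comp h.surjective)
      have hle : LinearMap.ker (ρ n ∘ₗ h.toLinearMap) ≤ LinearMap.ker (d n) :=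
        fun x hx => (hker x).mp hx
      refine ⟨(Submodule.liftQ _ (d n) hle) ∘ₗ e.symm.toLinearMap, ?_, ?_⟩
      · refine Function.Injective.comp (g := Submodule.liftQ _ (d n) hle) ?_ e.symm.injective
        refine LinearMap.ker_eq_bot.mp (Submodule.ker_liftQ_eq_bot _ _ _ fun x hx => ?_)
        exact (hker x).mpr hx
      · rw [LinearMap.range_comp_of_range_eq_top _ e.symm.range, Submodule.range_liftQ, hK]
  obtain ⟨f, hf, hfK⟩ := key n
  obtain ⟨h, -⟩ := exists_equiv_of_isEssential_range hf (hι n) (hfK ▸ hmin n) (hιs n)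
  exact ⟨h⟩

/-- A finite direct sum of injective modules is injective. -/
theorem injective_directSum {X : Type} [Finite X] (N : X → Type u) [∀ x, AddCommGroup (N x)]
    [∀ x, Module R (N x)] [∀ x, Module.Injective R (N x)] : Module.Injective R (⨁ x, N x) := by
  classical
  have := Fintype.ofFinite X
  refine ⟨fun A B _ _ _ _ f hf g => ?_⟩
  choose h hh using fun x => Module.Injective.out f hf (DirectSum.component R X N x ∘ₗ g)
  refine ⟨∑ x, DirectSum.lof R X N x ∘ₗ h x, fun a => ?_⟩
  simp only [LinearMap.sum_apply, LinearMap.comp_apply, hh]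
  exact DirectSum.sum_univ_of (g a)

end MinimalResolutions

/-! ### Combinatorics of the non-zero paths -/

section Combinatorics

variable {V : Type u} [Quiver.{u} V]

/-- The laws shared by the concatenation of paths `comp?` and by the concatenation in the opposite
order `flip comp?`. Everything about non-zero paths that follows from them holds both for initial
subpaths (`m = comp?`) and for terminal subpaths (`m = flip comp?`). -/
structure IsConcat (m : QPath V → QPath V → Option (QPath V)) : Prop where
  assoc : ∀ p q r, (m p q).bind (fun u => m u r) = (m q r).bind (fun u => m p u)
  length : ∀ {p q u}, m p q = some u → u.length = p.length + q.length
  eq_left : ∀ {p q u}, m p q = some u → q.length = 0 → u = p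
  eq_right : ∀ {p q u}, m p q = some u → p.length = 0 → u = q
  split : ∀ {n : ℕ} {u : QPath V}, n ≤ u.length → ∃ p q, m p q = some u ∧ p.length = n
  inj : ∀ {p q p' q' u}, m p q = some u → m p' q' = some u → p.length = p'.length →
    p = p' ∧ q = q'

/-- `a` is an initial subpath of `u` with respect to the concatenation `m`. -/
def Initial (m : QPath V → QPath V → Option (QPath V)) (a u : QPath V) : Prop :=
  ∃ r, m a r = some u

/-- `w = p γ q` for an arrow `γ`, with respect to the concatenation `m`. -/
def IsRemainder (m : QPath V → QPath V → Option (QPath V)) (p w q : QPath V) : Prop :=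
  ∃ γ v, γ.length = 1 ∧ m p γ = some v ∧ m v q = some w

namespace IsConcat

variable {m : QPath V → QPath V → Option (QPath V)} (hm : IsConcat m)
include hm

theorem assoc_left {p q r v u : QPath V} (h : m p q = some v) (h' : m v r = some u) :
    ∃ w, m q r = some w ∧ m p w = some u := by
  have := hm.assoc p q r
  rw [h, Option.bind_some, h'] at this
  exact Option.bind_eq_some_iff.mp this.symm

theorem assoc_right {p q r w u : QPath V} (h : m q r = some w) (h' : m p w = some u) :
    ∃ v, m p q = some v ∧ m v r = some u := by
  have := hm.assoc p q r
  rw [h, Option.bind_some, h'] at this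
  exact Option.bind_eq_some_iff.mp this

theorem flip : IsConcat (flip m) where
  assoc p q r := (hm.assoc r q p).symm
  length h := (hm.length h).trans (add_comm _ _)
  eq_left h := hm.eq_right h
  eq_right h := hm.eq_left h
  split {n u} hn := by
    obtain ⟨p, q, h, hp⟩ := hm.split (Nat.sub_le u.length n)
    have := hm.length h
    exact ⟨q, p, h, by omega⟩
  inj {p q p' q' u} h h' hl := by
    have h1 := hm.length h
    have h2 := hm.length h'
    exact (hm.inj h h' (by omega)).symm

theorem initial_refl (u : QPath V) : Initial m u u := by
  obtain ⟨p, q, h, hp⟩ := hm.split (le_refl u.length)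
  have h1 := hm.length h
  obtain rfl := hm.eq_left h (by omega)
  exact ⟨q, h⟩

theorem initial_trans {a b c : QPath V} (h : Initial m a b) (h' : Initial m b c) :
    Initial m a c := by
  obtain ⟨r, hr⟩ := h
  obtain ⟨s, hs⟩ := h'
  obtain ⟨w, -, hw⟩ := hm.assoc_left hr hs
  exact ⟨w, hw⟩

theorem length_le {a u : QPath V} (h : Initial m a u) : a.length ≤ u.length := by
  obtain ⟨r, hr⟩ := h
  have := hm.length hr
  omega

theorem initial_of_length_le {a b u : QPath V} (ha : Initial m a u) (hb : Initial m b u)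
    (hl : a.length ≤ b.length) : Initial m a b := by
  obtain ⟨r, hr⟩ := ha
  obtain ⟨s, hs⟩ := hb
  obtain ⟨p, q, hpq, hp⟩ := hm.split hl
  obtain ⟨w, -, hw⟩ := hm.assoc_left hpq hs
  obtain ⟨rfl, -⟩ := hm.inj hr hw hp.symm
  exact ⟨q, hpq⟩

theorem eq_of_initial {a b u : QPath V} (ha : Initial m a u) (hb : Initial m b u)
    (hl : a.length = b.length) : a = b := by
  obtain ⟨r, hr⟩ := ha
  obtain ⟨s, hs⟩ := hb
  exact (hm.inj hr hs hl).1

theorem isRemainder_unique {p w q q' : QPath V} (h : IsRemainder m p w q)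
    (h' : IsRemainder m p w q') : q = q' := by
  obtain ⟨γ, v, hγ, hv, hw⟩ := h
  obtain ⟨γ', v', hγ', hv', hw'⟩ := h'
  have h1 := hm.length hv
  have h2 := hm.length hv'
  exact (hm.inj hw hw' (by omega)).2

/-- A path strictly longer than its initial subpath `a` begins with `a` and one more arrow. -/
theorem exists_isRemainder {a u : QPath V} (h : Initial m a u) (hl : a.length < u.length) :
    ∃ γ v q, γ.length = 1 ∧ m a γ = some v ∧ m v q = some u := by
  obtain ⟨r, hr⟩ := h
  have h1 := hm.length hr
  obtain ⟨γ, q, hγq, hγ⟩ := hm.split (show 1 ≤ r.length by omega)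
  obtain ⟨v, hv, hvu⟩ := hm.assoc_right hγq hr
  exact ⟨γ, v, q, hγ, hv, hvu⟩

end IsConcat

/-- The properties of the set `N` of the non-zero paths of a string presentation, with respect to
the concatenation `m`. They are the ones that concern the continuation of paths on the right if
`m = comp?`, and on the left if `m = flip comp?`. -/
structure IsStringLike (m : QPath V → QPath V → Option (QPath V)) (N : QPath V → Prop) :
    Prop where
  concat : IsConcat m
  left : ∀ {p q u}, m p q = some u → N u → N p
  right : ∀ {p q u}, m p q = some u → N u → N q
  bounded : ∃ B, ∀ u, N u → u.length ≤ B
  /-- An arrow has at most one non-zero continuation. -/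
  deterministic : ∀ {α β γ u v}, α.length = 1 → β.length = 1 → γ.length = 1 →
    m α β = some u → m α γ = some v → N u → N v → β = γ
  /-- There are at most two arrows at a point `e`. -/
  two : ∀ {e α β γ}, e.length = 0 → α.length = 1 → β.length = 1 → γ.length = 1 →
    m e α = some α → m e β = some β → m e γ = some γ → α = β ∨ α = γ ∨ β = γ

/-- `w` is non-zero and has no non-zero continuation by an arrow. -/
def IsMaximalPath (m : QPath V → QPath V → Option (QPath V)) (N : QPath V → Prop)
    (w : QPath V) : Prop :=
  N w ∧ ∀ α u, α.length = 1 → m w α = some u → ¬ N u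

/-- `w₀` and `w₁` are the maximal non-zero paths starting at the stationary path `e`, where `q` is
an initial subpath of `w₀`. -/
structure IsMaximalPair (m : QPath V → QPath V → Option (QPath V)) (N : QPath V → Prop)
    (e q w₀ : QPath V) (w₁ : Option (QPath V)) : Prop where
  initial : Initial m q w₀
  ne : w₁ ≠ some w₀
  iff_maximal : ∀ w, (m e w = some w ∧ IsMaximalPath m N w) ↔ (w = w₀ ∨ w₁ = some w)

/-- `f 0` and `f 1` are the successors of `q` in a maximal sequence: what remains of `w₀` after
`q`, and what remains of `w₁` after its starting point `e`. -/
def IsStep (m : QPath V → QPath V → Option (QPath V)) (N : QPath V → Prop)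
    (e q : QPath V) (f : Fin 2 → Option (QPath V)) : Prop :=
  ∃ w₀ w₁, IsMaximalPair m N e q w₀ w₁ ∧
    (∀ q', f 0 = some q' ↔ IsRemainder m q w₀ q') ∧
    (∀ q', f 1 = some q' ↔ ∃ w, w₁ = some w ∧ IsRemainder m e w q')

/-- The non-zero paths starting at `e` that are not initial subpaths of `q` fall into disjoint
families, one for each successor `f i = q'` that exists: those of the form `(a i) v` with `v` an
initial subpath of `q'`. -/
structure IsBranching (m : QPath V → QPath V → Option (QPath V)) (N : QPath V → Prop)
    (e q : QPath V) (f : Fin 2 → Option (QPath V)) (a : Fin 2 → QPath V) : Prop where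
  start : ∀ {i q'}, f i = some q' → m e (a i) = some (a i)
  nonzero : ∀ {i q'}, f i = some q' → ∃ w, m (a i) q' = some w ∧ N w
  initial : ∀ {i q' u v}, f i = some q' → m (a i) u = some v → N v → Initial m u q'
  not_initial : ∀ {i q'}, f i = some q' → ¬ Initial m (a i) q
  exists_initial : ∀ {u}, N u → m e u = some u → ¬ Initial m u q →
    ∃ i q', f i = some q' ∧ Initial m (a i) u
  disjoint : ∀ {i j q' q'' u}, f i = some q' → f j = some q'' → N u → Initial m (a i) u →
    Initial m (a j) u → i = j

namespace IsStringLike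

variable {m : QPath V → QPath V → Option (QPath V)} {N : QPath V → Prop}
  (h : IsStringLike m N)
include h

/-- A non-stationary path has at most one non-zero continuation by an arrow. -/
theorem eq_of_comp {b β γ u v : QPath V} (hb : 1 ≤ b.length) (hβ : β.length = 1)
    (hγ : γ.length = 1) (hu : m b β = some u) (hv : m b γ = some v) (hNu : N u) (hNv : N v) :
    u = v := by
  obtain ⟨c, α, hcα, hc⟩ := h.concat.split (Nat.sub_le b.length 1)
  have hα : α.length = 1 := by have := h.concat.length hcα; omega
  obtain ⟨x, hx, hxu⟩ := h.concat.assoc_left hcα hu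
  obtain ⟨y, hy, hyv⟩ := h.concat.assoc_left hcα hv
  obtain rfl := h.deterministic hα hβ hγ hx hy (h.right hxu hNu) (h.right hyv hNv)
  exact Option.some.inj (hu.symm.trans hv)

/-- Two non-zero paths with the same first arrow are comparable. -/
theorem initial_of_common {a u w : QPath V} (ha : 1 ≤ a.length) (hau : Initial m a u)
    (haw : Initial m a w) (hu : N u) (hw : N w) (hl : u.length ≤ w.length) : Initial m u w := by
  have key : ∀ n, a.length + n ≤ u.length →
      ∃ b, b.length = a.length + n ∧ Initial m b u ∧ Initial m b w := by
    intro n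
    induction n with
    | zero => exact fun _ => ⟨a, rfl, hau, haw⟩
    | succ n ih =>
      intro hn
      obtain ⟨b, hb, hbu, hbw⟩ := ih (by omega)
      obtain ⟨β, x, r, hβ, hx, hxu⟩ := h.concat.exists_isRemainder hbu (by omega)
      obtain ⟨γ, y, s, hγ, hy, hyw⟩ := h.concat.exists_isRemainder hbw (by omega)
      obtain rfl := h.eq_of_comp (by omega) hβ hγ hx hy (h.left hxu hu) (h.left hyw hw)
      have := h.concat.length hx
      exact ⟨x, by omega, ⟨r, hxu⟩, ⟨s, hyw⟩⟩
  have := h.concat.length_le hau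
  obtain ⟨b, hb, hbu, hbw⟩ := key (u.length - a.length) (by omega)
  rwa [h.concat.eq_of_initial hbu (h.concat.initial_refl u) (by omega)] at hbw

theorem eq_of_isMaximalPath {w u : QPath V} (hw : IsMaximalPath m N w) (hwu : Initial m w u)
    (hu : N u) : u = w := by
  rcases (h.concat.length_le hwu).lt_or_eq with hlt | heq
  · obtain ⟨γ, v, q, hγ, hv, hvu⟩ := h.concat.exists_isRemainder hwu hlt
    exact absurd (h.left hvu hu) (hw.2 γ v hγ hv)
  · exact (h.concat.eq_of_initial hwu (h.concat.initial_refl u) heq).symm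

theorem initial_of_isMaximalPath {a u w : QPath V} (ha : 1 ≤ a.length) (hau : Initial m a u)
    (haw : Initial m a w) (hu : N u) (hw : IsMaximalPath m N w) : Initial m u w := by
  rcases le_total u.length w.length with hl | hl
  · exact h.initial_of_common ha hau haw hu hw.1 hl
  · rw [h.eq_of_isMaximalPath hw (h.initial_of_common ha haw hau hw.1 hu hl) hu]
    exact h.concat.initial_refl w

theorem eq_of_common {a w w' : QPath V} (ha : 1 ≤ a.length) (haw : Initial m a w)
    (haw' : Initial m a w') (hw : IsMaximalPath m N w) (hw' : IsMaximalPath m N w') : w = w' :=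
  (h.eq_of_isMaximalPath hw (h.initial_of_isMaximalPath ha haw haw' hw.1 hw') hw'.1).symm

theorem exists_isMaximalPath {u : QPath V} (hu : N u) :
    ∃ w, IsMaximalPath m N w ∧ Initial m u w := by
  obtain ⟨B, hB⟩ := h.bounded
  induction hn : B - u.length generalizing u with
  | zero =>
    refine ⟨u, ⟨hu, fun α v hα hv hNv => ?_⟩, h.concat.initial_refl u⟩
    have h1 := hB v hNv
    have h2 := h.concat.length hv
    omega
  | succ n ih =>
    by_cases hmax : IsMaximalPath m N u
    · exact ⟨u, hmax, h.concat.initial_refl u⟩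
    · simp only [IsMaximalPath, hu, true_and] at hmax
      push Not at hmax
      obtain ⟨α, v, hα, hv, hNv⟩ := hmax
      have h2 := h.concat.length hv
      obtain ⟨w, hw, hvw⟩ := ih hNv (by omega)
      exact ⟨w, hw, h.concat.initial_trans ⟨α, hv⟩ hvw⟩

theorem start_of_initial {e a u : QPath V} (hau : Initial m a u) (ha : m e a = some a) :
    m e u = some u := by
  obtain ⟨r, hr⟩ := hau
  obtain ⟨w, hw, hw'⟩ := h.concat.assoc_left ha hr
  rwa [Option.some.inj (hw.symm.trans hr)] at hw'

theorem start_of_initial' {e a u : QPath V} (he : e.length = 0) (hau : Initial m a u)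
    (hu : m e u = some u) : m e a = some a := by
  obtain ⟨r, hr⟩ := hau
  obtain ⟨v, hv, -⟩ := h.concat.assoc_right hr hu
  rwa [h.concat.eq_right hv he] at hv

/-- A path of positive length starting at `e` begins with an arrow starting at `e`. -/
theorem exists_arrow {e w : QPath V} (he : e.length = 0) (hew : m e w = some w)
    (hw : 1 ≤ w.length) : ∃ α, α.length = 1 ∧ m e α = some α ∧ Initial m α w := by
  obtain ⟨α, r, hαr, hα⟩ := h.concat.split hw
  exact ⟨α, hα, h.start_of_initial' he ⟨r, hαr⟩ hew, ⟨r, hαr⟩⟩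

/-- If one maximal path starting at `e` is stationary, then it is the only one. -/
theorem eq_of_length_eq_zero {e w w' : QPath V} (he : e.length = 0) (hew : m e w = some w)
    (hew' : m e w' = some w') (hw : IsMaximalPath m N w) (hw0 : w.length = 0)
    (hw' : IsMaximalPath m N w') : w' = w := by
  obtain rfl : w = e := h.concat.eq_left hew hw0
  exact h.eq_of_isMaximalPath hw ⟨w', hew'⟩ hw'.1

/-- There are at most two maximal paths starting at `e`, as distinct ones have distinct first
arrows. -/
theorem two_maximal {e w w' w'' : QPath V} (he : e.length = 0) (hew : m e w = some w)
    (hew' : m e w' = some w') (hew'' : m e w'' = some w'') (hw : IsMaximalPath m N w)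
    (hw' : IsMaximalPath m N w') (hw'' : IsMaximalPath m N w'') :
    w = w' ∨ w = w'' ∨ w' = w'' := by
  rcases Nat.eq_zero_or_pos w.length with h0 | h0
  · exact Or.inl (h.eq_of_length_eq_zero he hew hew' hw h0 hw').symm
  rcases Nat.eq_zero_or_pos w'.length with h1 | h1
  · exact Or.inl (h.eq_of_length_eq_zero he hew' hew hw' h1 hw)
  rcases Nat.eq_zero_or_pos w''.length with h2 | h2
  · exact Or.inr (Or.inl (h.eq_of_length_eq_zero he hew'' hew hw'' h2 hw))
  obtain ⟨α, hα, heα, hαw⟩ := h.exists_arrow he hew h0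
  obtain ⟨β, hβ, heβ, hβw⟩ := h.exists_arrow he hew' h1
  obtain ⟨γ, hγ, heγ, hγw⟩ := h.exists_arrow he hew'' h2
  rcases h.two he hα hβ hγ heα heβ heγ with rfl | rfl | rfl
  · exact Or.inl (h.eq_of_common hα.ge hαw hβw hw hw')
  · exact Or.inr (Or.inl (h.eq_of_common hα.ge hαw hγw hw hw''))
  · exact Or.inr (Or.inr (h.eq_of_common hβ.ge hβw hγw hw' hw''))

theorem exists_isMaximalPair {e q : QPath V} (he : e.length = 0) (heq : m e q = some q)
    (hq : N q) : ∃ w₀ w₁, IsMaximalPair m N e q w₀ w₁ := by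
  obtain ⟨w₀, hw₀, hqw₀⟩ := h.exists_isMaximalPath hq
  have hew₀ := h.start_of_initial hqw₀ heq
  by_cases hex : ∃ w, (m e w = some w ∧ IsMaximalPath m N w) ∧ w ≠ w₀
  · obtain ⟨w₁, ⟨hew₁, hw₁⟩, hne⟩ := hex
    refine ⟨w₀, some w₁, hqw₀, fun h' => hne (Option.some.inj h'), fun w => ⟨?_, ?_⟩⟩
    · rintro ⟨hew, hw⟩
      rcases h.two_maximal he hew hew₀ hew₁ hw hw₀ hw₁ with h' | h' | h'
      · exact Or.inl h'
      · exact Or.inr (by rw [h'])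
      · exact absurd h'.symm hne
    · rintro (rfl | h')
      · exact ⟨hew₀, hw₀⟩
      · obtain rfl := Option.some.inj h'
        exact ⟨hew₁, hw₁⟩
  · push Not at hex
    refine ⟨w₀, none, hqw₀, by simp, fun w => ⟨fun hw => Or.inl (hex w hw), ?_⟩⟩
    rintro (rfl | h')
    · exact ⟨hew₀, hw₀⟩
    · cases h'

theorem exists_isStep {e q : QPath V} (he : e.length = 0) (heq : m e q = some q) (hq : N q) :
    ∃ f, IsStep m N e q f := by
  classical
  obtain ⟨w₀, w₁, hw⟩ := h.exists_isMaximalPair he heq hq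
  have key : ∀ P : QPath V → Prop, (∀ q q', P q → P q' → q = q') →
      ∃ o : Option (QPath V), ∀ q', o = some q' ↔ P q' := by
    intro P hP
    by_cases hex : ∃ q, P q
    · obtain ⟨q, hq⟩ := hex
      refine ⟨some q, fun q' => ⟨fun h' => Option.some.inj h' ▸ hq, fun h' => ?_⟩⟩
      rw [hP q q' hq h']
    · exact ⟨none, fun q' => ⟨fun h' => (Option.some_ne_none _ h'.symm).elim,
        fun h' => absurd ⟨q', h'⟩ hex⟩⟩
  obtain ⟨f₀, hf₀⟩ := key (IsRemainder m q w₀) fun _ _ => h.concat.isRemainder_unique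
  obtain ⟨f₁, hf₁⟩ := key (fun q' => ∃ w, w₁ = some w ∧ IsRemainder m e w q') <| by
    rintro q q' ⟨w, hw, hq⟩ ⟨w', hw', hq'⟩
    obtain rfl := Option.some.inj (hw.symm.trans hw')
    exact h.concat.isRemainder_unique hq hq'
  exact ⟨![f₀, f₁], w₀, w₁, hw, hf₀, hf₁⟩

/-- The successors of `q` in a maximal sequence partition the non-zero paths starting at `e` that
are not initial subpaths of `q`: such a path continues to a maximal one, that is to `w₀` or `w₁`, and
two maximal paths with a common arrow are equal. -/
theorem exists_isBranching {e q : QPath V} {f : Fin 2 → Option (QPath V)} (he : e.length = 0)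
    (heq : m e q = some q) (hf : IsStep m N e q f) : ∃ a, IsBranching m N e q f a := by
  classical
  obtain ⟨w₀, w₁, hw, hf₀, hf₁⟩ := hf
  obtain ⟨hew₀, hw₀⟩ := (hw.iff_maximal w₀).mpr (Or.inl rfl)
  have hne : ∀ {w}, w₁ = some w → w ≠ w₀ := fun h' h'' => hw.ne (h'' ▸ h')
  have hmax₁ : ∀ {w}, w₁ = some w → m e w = some w ∧ IsMaximalPath m N w :=
    fun h' => (hw.iff_maximal _).mpr (Or.inr h')
  -- `a 0` is `q` with one more arrow, and `a 1` is the first arrow of `w₁`.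
  have ha₀ : ∃ a, ∀ q', f 0 = some q' → a.length = q.length + 1 ∧ Initial m q a ∧
      m a q' = some w₀ := by
    cases h0 : f 0 with
    | none => exact ⟨q, by simp⟩
    | some q' =>
      obtain ⟨γ, v, hγ, hv, hvw⟩ := (hf₀ q').mp h0
      refine ⟨v, fun q'' h' => ?_⟩
      obtain rfl := Option.some.inj h'
      exact ⟨by rw [h.concat.length hv, hγ], ⟨γ, hv⟩, hvw⟩
  have ha₁ : ∃ a, ∀ q', f 1 = some q' → a.length = 1 ∧ ∃ w, w₁ = some w ∧ m a q' = some w := by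
    cases h1 : f 1 with
    | none => exact ⟨q, by simp⟩
    | some q' =>
      obtain ⟨w, hw₁, γ, v, hγ, hv, hvw⟩ := (hf₁ q').mp h1
      refine ⟨v, fun q'' h' => ?_⟩
      obtain rfl := Option.some.inj h'
      exact ⟨by rw [h.concat.length hv, hγ, he], w, hw₁, hvw⟩
  obtain ⟨a₀, ha₀⟩ := ha₀
  obtain ⟨a₁, ha₁⟩ := ha₁
  have hdisj : ∀ {q' q'' u}, f 0 = some q' → f 1 = some q'' → N u → Initial m a₀ u →
      Initial m a₁ u → False := by
    intro q' q'' u h0 h1 hu h2 h3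
    obtain ⟨hl₀, -, hw₀'⟩ := ha₀ q' h0
    obtain ⟨hl₁, w, hww₁, hw'⟩ := ha₁ q'' h1
    have h4 := h.initial_of_isMaximalPath (by omega) h2 ⟨_, hw₀'⟩ hu hw₀
    exact hne hww₁ (h.eq_of_common hl₁.ge ⟨_, hw'⟩ (h.concat.initial_trans h3 h4)
      (hmax₁ hww₁).2 hw₀)
  have hmax : ∀ (i : Fin 2) {q'}, f i = some q' → 1 ≤ (![a₀, a₁] i).length ∧
      ∃ w, m e w = some w ∧ IsMaximalPath m N w ∧ m (![a₀, a₁] i) q' = some w := by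
    intro i q' hi
    fin_cases i
    · obtain ⟨hl₀, -, hw₀'⟩ := ha₀ q' hi
      exact ⟨by simp [hl₀], w₀, hew₀, hw₀, hw₀'⟩
    · obtain ⟨hl₁, w, hww₁, hw'⟩ := ha₁ q' hi
      exact ⟨by simp [hl₁], w, (hmax₁ hww₁).1, (hmax₁ hww₁).2, hw'⟩
  refine ⟨![a₀, a₁], ⟨?_, ?_, ?_, ?_, ?_, ?_⟩⟩
  · intro i q' hi
    obtain ⟨-, w, hew, -, hw'⟩ := hmax i hi
    exact h.start_of_initial' he ⟨_, hw'⟩ hew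
  · intro i q' hi
    obtain ⟨-, w, -, hw, hw'⟩ := hmax i hi
    exact ⟨w, hw', hw.1⟩
  · intro i q' u v hi huv hv
    obtain ⟨hl, w, -, hw, hw'⟩ := hmax i hi
    obtain ⟨r, hr⟩ := h.initial_of_isMaximalPath hl ⟨u, huv⟩ ⟨q', hw'⟩ hv hw
    obtain ⟨x, hx, hxw⟩ := h.concat.assoc_left huv hr
    obtain ⟨-, rfl⟩ := h.concat.inj hw' hxw rfl
    exact ⟨r, hx⟩
  · intro i q' hi hiq
    fin_cases i
    · have h1 := h.concat.length_le hiq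
      have h2 := (ha₀ q' hi).1
      simp only [Fin.zero_eta, Matrix.cons_val_zero] at h1
      omega
    · obtain ⟨hl₁, w, hww₁, hw'⟩ := ha₁ q' hi
      exact hne hww₁ (h.eq_of_common hl₁.ge ⟨_, hw'⟩ (h.concat.initial_trans hiq hw.initial)
        (hmax₁ hww₁).2 hw₀)
  · intro u hu heu huq
    obtain ⟨w, hwmax, huw⟩ := h.exists_isMaximalPath hu
    have hew := h.start_of_initial huw heu
    rcases (hw.iff_maximal w).mp ⟨hew, hwmax⟩ with rfl | hww₁
    · have hlt : q.length < u.length := by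
        by_contra hle
        exact huq (h.concat.initial_of_length_le huw hw.initial (by omega))
      have hqu := h.concat.initial_of_length_le hw.initial huw hlt.le
      obtain ⟨γ, v, r, hγ, hv, hvu⟩ := h.concat.exists_isRemainder hqu hlt
      obtain ⟨s, hs⟩ := huw
      obtain ⟨q', -, hq'⟩ := h.concat.assoc_left hvu hs
      have h0 : f 0 = some q' := (hf₀ q').mpr ⟨γ, v, hγ, hv, hq'⟩
      obtain ⟨hl₀, -, hw₀'⟩ := ha₀ q' h0
      have : a₀ = v := h.concat.eq_of_initial ⟨_, hw₀'⟩ ⟨_, hq'⟩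
        (by rw [hl₀, h.concat.length hv, hγ])
      exact ⟨0, q', h0, r, by simpa [this] using hvu⟩
    · have hpos : 1 ≤ u.length := by
        by_contra h0
        obtain rfl := h.concat.eq_left heu (by omega)
        exact huq ⟨q, heq⟩
      obtain ⟨α, hα, heα, r, hr⟩ := h.exists_arrow he heu hpos
      obtain ⟨s, hs⟩ := huw
      obtain ⟨q', -, hq'⟩ := h.concat.assoc_left hr hs
      have h1 : f 1 = some q' := (hf₁ q').mpr ⟨w, hww₁, α, α, hα, heα, hq'⟩
      obtain ⟨hl₁, w', hww₁', hw'⟩ := ha₁ q' h1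
      obtain rfl := Option.some.inj (hww₁.symm.trans hww₁')
      have : a₁ = α := h.concat.eq_of_initial ⟨_, hw'⟩ ⟨_, hq'⟩ (by rw [hl₁, hα])
      exact ⟨1, q', h1, r, by simpa [this] using hr⟩
  · intro i j q' q'' u hi hj hu hiu hju
    fin_cases i <;> fin_cases j
    · rfl
    · exact (hdisj hi hj hu hiu hju).elim
    · exact (hdisj hj hi hu hju hiu).elim
    · rfl

end IsStringLike

end Combinatorics

/-! ### Concatenation of paths and non-zero paths -/

section Paths

variable {V : Type u} [Quiver.{u} V]

namespace QPath

/-- To prove something about a concatenation that exists, one may assume that the end points match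
definitionally. -/
theorem comp?_elim {P : QPath V → QPath V → QPath V → Prop}
    (h : ∀ {a b c : V} (p : Quiver.Path a b) (q : Quiver.Path b c), P ⟨p⟩ ⟨q⟩ ⟨p.comp q⟩)
    {p q u : QPath V} (hu : comp? p q = some u) : P p q u := by
  obtain @⟨a, b, p⟩ := p
  obtain @⟨c, d, q⟩ := q
  by_cases hbc : b = c
  · subst hbc
    rw [comp?_mk] at hu
    obtain rfl := Option.some.inj hu
    exact h p q
  · rw [comp?_of_ne hbc] at hu
    cases hu

theorem comp?_src {p q u : QPath V} (hu : comp? p q = some u) : u.src = p.src :=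
  comp?_elim (P := fun p _ u => u.src = p.src) (fun _ _ => rfl) hu

theorem comp?_tgt {p q u : QPath V} (hu : comp? p q = some u) : u.tgt = q.tgt :=
  comp?_elim (P := fun _ q u => u.tgt = q.tgt) (fun _ _ => rfl) hu

theorem eq_nil_of_length_eq_zero {p : QPath V} (h : p.length = 0) :
    p = nil p.src ∧ p = nil p.tgt := by
  obtain ⟨_ | _⟩ := p
  · exact ⟨rfl, rfl⟩
  · simp [length] at h

theorem exists_arrow_of_length_eq_one {p : QPath V} (h : p.length = 1) :
    ∃ (x y : V) (α : x ⟶ y), p = arrow α := by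
  obtain ⟨p⟩ := p
  cases p with
  | nil => simp [length] at h
  | cons p α =>
    cases p with
    | nil => exact ⟨_, _, α, rfl⟩
    | cons => simp [length] at h

theorem nil_comp?_iff {x : V} {u v : QPath V} : comp? (nil x) u = some v ↔ u.src = x ∧ v = u := by
  constructor
  · intro h
    have hx : u.src = x := by
      by_contra hne
      rw [comp?_of_ne (show (nil x).tgt ≠ u.src from Ne.symm hne)] at h
      cases h
    subst hx
    rw [nil_comp?] at h
    exact ⟨rfl, (Option.some.inj h).symm⟩
  · rintro ⟨rfl, rfl⟩
    exact nil_comp? v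

theorem comp?_nil_iff {x : V} {u v : QPath V} : comp? u (nil x) = some v ↔ u.tgt = x ∧ v = u := by
  constructor
  · intro h
    have hx : u.tgt = x := by
      by_contra hne
      rw [comp?_of_ne (show u.tgt ≠ (nil x).src from hne)] at h
      cases h
    subst hx
    rw [comp?_nil] at h
    exact ⟨rfl, (Option.some.inj h).symm⟩
  · rintro ⟨rfl, rfl⟩
    exact comp?_nil v

/-- Two factorizations of a path with second factors of equal length agree. The points at which the
path is cut are not assumed to be the same. -/
theorem eq_of_comp_eq_comp {a b c : V} (p : Quiver.Path a b) (q : Quiver.Path b c) :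
    ∀ {b' : V} (p' : Quiver.Path a b') (q' : Quiver.Path b' c), q.length = q'.length →
      p.comp q = p'.comp q' → (⟨p⟩ : QPath V) = ⟨p'⟩ ∧ (⟨q⟩ : QPath V) = ⟨q'⟩ := by
  induction q with
  | nil =>
    intro b' p' q' hl he
    cases q' with
    | nil => exact ⟨congrArg _ he, rfl⟩
    | cons => simp at hl
  | cons q α ih =>
    intro b' p' q' hl he
    cases q' with
    | nil => simp at hl
    | cons q' α' =>
      rw [Quiver.Path.comp_cons, Quiver.Path.comp_cons] at he
      obtain rfl := Quiver.Path.obj_eq_of_cons_eq_cons he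
      have h1 := eq_of_heq (Quiver.Path.heq_of_cons_eq_cons he)
      obtain rfl := eq_of_heq (Quiver.Path.hom_heq_of_cons_eq_cons he)
      obtain ⟨h2, h3⟩ := ih p' q' (by simpa using hl) h1
      refine ⟨h2, ?_⟩
      cases h3
      rfl

theorem isConcat_comp? : IsConcat (comp? (V := V)) where
  assoc := comp?_assoc
  length h := comp?_elim (P := fun p q u => u.length = p.length + q.length)
    (fun p q => Quiver.Path.length_comp p q) h
  eq_left {p q u} h hq := by
    rw [(eq_nil_of_length_eq_zero hq).1] at h
    exact (comp?_nil_iff.mp h).2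
  eq_right {p q u} h hp := by
    rw [(eq_nil_of_length_eq_zero hp).1] at h
    exact (nil_comp?_iff.mp h).2
  split {n u} hn := by
    obtain ⟨v, p, q, h, hp⟩ := Quiver.Path.exists_eq_comp_of_le_length u.path hn
    exact ⟨⟨p⟩, ⟨q⟩, by rw [comp?_mk, ← h], hp⟩
  inj {p q p' q' u} h h' hl := by
    revert p' q' h' hl
    refine comp?_elim (P := fun p q u => ∀ {p' q' : QPath V}, comp? p' q' = some u →
      p.length = p'.length → p = p' ∧ q = q') ?_ h
    intro a b c p q p' q' h'
    obtain @⟨a', b', p'⟩ := p'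
    obtain @⟨b'', c', q'⟩ := q'
    by_cases hb : b' = b''
    · subst hb
      rw [comp?_mk] at h'
      intro hl
      replace h' := Option.some.inj h'
      obtain rfl : a' = a := congrArg QPath.src h'
      obtain rfl : c' = c := congrArg QPath.tgt h'
      have h1 : p'.comp q' = p.comp q := by
        injection h' with _ _ h'
      have h2 := congrArg Quiver.Path.length h1
      rw [Quiver.Path.length_comp, Quiver.Path.length_comp] at h2
      replace hl : p.length = p'.length := hl
      exact eq_of_comp_eq_comp p q p' q' (by omega) h1.symm
    · rw [comp?_of_ne hb] at h'
      cases h'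

theorem isPrefix_iff {u p : QPath V} : u.IsPrefix p ↔ Initial comp? u p := by
  constructor
  · rintro ⟨z, r, rfl⟩
    exact ⟨⟨r⟩, comp?_mk _ _⟩
  · rintro ⟨r, h⟩
    exact comp?_elim (P := fun u _ p => u.IsPrefix p) (fun p q => ⟨_, q, rfl⟩) h

theorem isSuffix_iff {u p : QPath V} : u.IsSuffix p ↔ Initial (flip comp?) u p := by
  constructor
  · rintro ⟨z, r, rfl⟩
    exact ⟨⟨r⟩, comp?_mk _ _⟩
  · rintro ⟨r, h⟩
    exact comp?_elim (P := fun _ u p => u.IsSuffix p) (fun p q => ⟨_, p, rfl⟩) h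

theorem isPrefix_refl (u : QPath V) : u.IsPrefix u :=
  isPrefix_iff.mpr (isConcat_comp?.initial_refl u)

theorem isPrefix_nil (u : QPath V) : (nil u.src).IsPrefix u := isPrefix_iff.mpr ⟨u, nil_comp? u⟩

theorem src_eq_of_isPrefix {w p : QPath V} (hw : w.IsPrefix p) : w.src = p.src := by
  obtain ⟨r, hr⟩ := isPrefix_iff.mp hw
  exact (comp?_src hr).symm

instance finite_isPrefix (p : QPath V) : Finite {w : QPath V // w.IsPrefix p} := by
  let f : {w : QPath V // w.IsPrefix p} → Fin (p.length + 1) := fun w =>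
    ⟨w.1.length, Nat.lt_succ_of_le (isConcat_comp?.length_le (isPrefix_iff.mp w.2))⟩
  refine Finite.of_injective f fun w w' h => Subtype.ext ?_
  exact isConcat_comp?.eq_of_initial (isPrefix_iff.mp w.2) (isPrefix_iff.mp w'.2)
    (congrArg Fin.val h)

theorem exists_comp_arrow {p γ v : QPath V} (hγ : γ.length = 1) (h : comp? p γ = some v) :
    ∃ (z : V) (α : p.tgt ⟶ z), v = ⟨p.path.comp α.toPath⟩ := by
  refine comp?_elim (P := fun p γ v => γ.length = 1 →
    ∃ (z : V) (α : p.tgt ⟶ z), v = ⟨p.path.comp α.toPath⟩) ?_ h hγ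
  intro a b c p γ hγ
  cases γ with
  | nil => simp [length] at hγ
  | cons γ α =>
    cases γ with
    | nil => exact ⟨_, α, rfl⟩
    | cons => simp [length] at hγ

theorem exists_arrow_comp {p γ v : QPath V} (hγ : γ.length = 1) (h : comp? γ p = some v) :
    ∃ (z : V) (α : z ⟶ p.src), v = ⟨α.toPath.comp p.path⟩ := by
  refine comp?_elim (P := fun γ p v => γ.length = 1 →
    ∃ (z : V) (α : z ⟶ p.src), v = ⟨α.toPath.comp p.path⟩) ?_ h hγ
  intro a b c γ p hγ
  cases γ with
  | nil => simp [length] at hγ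
  | cons γ α =>
    cases γ with
    | nil => exact ⟨_, α, rfl⟩
    | cons => simp [length] at hγ

theorem isRightRemainder_iff {p w q : QPath V} :
    p.IsRightRemainder w q ↔ IsRemainder comp? p w q := by
  constructor
  · rintro ⟨γ, rfl⟩
    exact ⟨arrow γ, _, rfl, comp?_mk _ _, by rw [← Quiver.Path.comp_assoc]; exact comp?_mk _ _⟩
  · rintro ⟨γ, v, hγ, hv, hw⟩
    obtain ⟨z, α, rfl⟩ := exists_comp_arrow hγ hv
    obtain @⟨a, b, q⟩ := q
    by_cases hz : z = a
    · subst hz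
      rw [comp?_mk] at hw
      exact ⟨α, by rw [← Option.some.inj hw, Quiver.Path.comp_assoc]⟩
    · rw [comp?_of_ne hz] at hw
      cases hw

theorem isLeftRemainder_iff {p w q : QPath V} :
    p.IsLeftRemainder w q ↔ IsRemainder (flip comp?) p w q := by
  constructor
  · rintro ⟨γ, rfl⟩
    exact ⟨arrow γ, _, rfl, comp?_mk _ _, comp?_mk _ _⟩
  · rintro ⟨γ, v, hγ, hv, hw⟩
    obtain ⟨z, α, rfl⟩ := exists_arrow_comp hγ hv
    obtain @⟨a, b, q⟩ := q
    replace hw : comp? ⟨q⟩ ⟨α.toPath.comp p.path⟩ = some w := hw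
    by_cases hz : b = z
    · subst hz
      rw [comp?_mk] at hw
      exact ⟨α, (Option.some.inj hw).symm⟩
    · rw [comp?_of_ne hz] at hw
      cases hw

end QPath

end Paths

section NonzeroPaths

open QPath

variable {k V : Type u} [Field k] [Quiver.{u} V] [Fintype V] {I : TwoSidedIdeal (PathAlgebra k V)}

theorem ofPath_mul_of_comp? {p q u : QPath V} (h : comp? p q = some u) :
    PathAlgebra.ofPath k p * PathAlgebra.ofPath k q = PathAlgebra.ofPath k u := by
  rw [PathAlgebra.ofPath_mul_ofPath, h]
  rfl

theorem IsNonzeroPath.left {p q u : QPath V} (h : comp? p q = some u) (hu : IsNonzeroPath I u) :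
    IsNonzeroPath I p := fun hp => hu <| by
  rw [← ofPath_mul_of_comp? h]
  exact TwoSidedIdeal.mul_mem_right _ _ _ hp

theorem IsNonzeroPath.right {p q u : QPath V} (h : comp? p q = some u)
    (hu : IsNonzeroPath I u) : IsNonzeroPath I q := fun hq => hu <| by
  rw [← ofPath_mul_of_comp? h]
  exact TwoSidedIdeal.mul_mem_left _ _ _ hq

theorem IsStringPresentation.exists_length_bound (hI : IsStringPresentation I) :
    ∃ B, ∀ u, IsNonzeroPath I u → u.length ≤ B := by
  obtain ⟨⟨B, -, hB⟩, -⟩ := hI.admissible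
  refine ⟨B, fun u hu => ?_⟩
  by_contra hlt
  obtain ⟨p, q, hpq, hp⟩ := isConcat_comp?.split (show B ≤ u.length by omega)
  exact hu.left hpq (hB (TwoSidedIdeal.subset_span ⟨p, hp, rfl⟩))

theorem exists_eq_of_card_le_two {X : Type u} (h : ENat.card X ≤ 2) (a b c : X) :
    a = b ∨ a = c ∨ b = c := by
  by_contra hne
  push Not at hne
  have hinj : Function.Injective ![a, b, c] := by
    intro i j hij
    fin_cases i <;> fin_cases j <;> simp_all
  have h1 := ENat.card_le_card_of_injective hinj
  simp only [ENat.card_eq_coe_fintype_card, Fintype.card_fin] at h1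
  exact absurd (h1.trans h) (by decide)

theorem IsStringPresentation.isStringLike (hI : IsStringPresentation I) :
    IsStringLike comp? (IsNonzeroPath I) where
  concat := isConcat_comp?
  left := IsNonzeroPath.left
  right := IsNonzeroPath.right
  bounded := hI.exists_length_bound
  deterministic {α β γ u v} hα hβ hγ hu hv hNu hNv := by
    obtain ⟨x, y, α, rfl⟩ := exists_arrow_of_length_eq_one hα
    obtain ⟨y', z, β, rfl⟩ := exists_arrow_of_length_eq_one hβ
    obtain ⟨y'', z', γ, rfl⟩ := exists_arrow_of_length_eq_one hγ
    obtain rfl : y = y' := by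
      by_contra hne
      rw [comp?_of_ne hne] at hu
      cases hu
    obtain rfl : y = y'' := by
      by_contra hne
      rw [comp?_of_ne hne] at hv
      cases hv
    obtain rfl := Option.some.inj ((comp?_mk _ _).symm.trans hu)
    obtain rfl := Option.some.inj ((comp?_mk _ _).symm.trans hv)
    have := hI.right_unique α (show ⟨z, β⟩ ∈ _ from hNu) (show ⟨z', γ⟩ ∈ _ from hNv)
    cases this
    rfl
  two {e α β γ} he hα hβ hγ heα heβ heγ := by
    rw [(eq_nil_of_length_eq_zero he).1] at heα heβ heγ
    obtain ⟨x, y, α, rfl⟩ := exists_arrow_of_length_eq_one hα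
    obtain ⟨x', y', β, rfl⟩ := exists_arrow_of_length_eq_one hβ
    obtain ⟨x'', y'', γ, rfl⟩ := exists_arrow_of_length_eq_one hγ
    obtain rfl : x' = x := (nil_comp?_iff.mp heβ).1.trans (nil_comp?_iff.mp heα).1.symm
    obtain rfl : x'' = x' := (nil_comp?_iff.mp heγ).1.trans (nil_comp?_iff.mp heα).1.symm
    rcases exists_eq_of_card_le_two (hI.source_le_two x'') ⟨y, α⟩ ⟨y', β⟩ ⟨y'', γ⟩ with h | h | h
      <;> cases h <;> simp

/-- The left-right mirror image of `IsStringPresentation.isStringLike`, for continuations of paths on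
the left. -/
theorem IsStringPresentation.isStringLike_flip (hI : IsStringPresentation I) :
    IsStringLike (flip comp?) (IsNonzeroPath I) where
  concat := isConcat_comp?.flip
  left h hu := IsNonzeroPath.right h hu
  right h hu := IsNonzeroPath.left h hu
  bounded := hI.exists_length_bound
  deterministic {α β γ u v} hα hβ hγ hu hv hNu hNv := by
    obtain ⟨x, y, α, rfl⟩ := exists_arrow_of_length_eq_one hα
    obtain ⟨z, x', β, rfl⟩ := exists_arrow_of_length_eq_one hβ
    obtain ⟨z', x'', γ, rfl⟩ := exists_arrow_of_length_eq_one hγ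
    replace hu : comp? (arrow β) (arrow α) = some u := hu
    replace hv : comp? (arrow γ) (arrow α) = some v := hv
    obtain rfl : x' = x := by
      by_contra hne
      rw [comp?_of_ne hne] at hu
      cases hu
    obtain rfl : x'' = x' := by
      by_contra hne
      rw [comp?_of_ne hne] at hv
      cases hv
    obtain rfl := Option.some.inj ((comp?_mk _ _).symm.trans hu)
    obtain rfl := Option.some.inj ((comp?_mk _ _).symm.trans hv)
    have := hI.left_unique α (show ⟨z, β⟩ ∈ _ from hNu) (show ⟨z', γ⟩ ∈ _ from hNv)
    cases this
    rfl
  two {e α β γ} he hα hβ hγ heα heβ heγ := by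
    rw [(eq_nil_of_length_eq_zero he).1] at heα heβ heγ
    obtain ⟨x, y, α, rfl⟩ := exists_arrow_of_length_eq_one hα
    obtain ⟨x', y', β, rfl⟩ := exists_arrow_of_length_eq_one hβ
    obtain ⟨x'', y'', γ, rfl⟩ := exists_arrow_of_length_eq_one hγ
    obtain rfl : y' = y := (comp?_nil_iff.mp heβ).1.trans (comp?_nil_iff.mp heα).1.symm
    obtain rfl : y'' = y' := (comp?_nil_iff.mp heγ).1.trans (comp?_nil_iff.mp heα).1.symm
    rcases exists_eq_of_card_le_two (hI.target_le_two y'') ⟨x, α⟩ ⟨x', β⟩ ⟨x'', γ⟩ with h | h | h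
      <;> cases h <;> simp

theorem isMaximalFrom_iff {x : V} {w : QPath V} : IsMaximalFrom I x w ↔
    comp? (nil x) w = some w ∧ IsMaximalPath comp? (IsNonzeroPath I) w := by
  rw [nil_comp?_iff, IsMaximalFrom, IsMaximalPath]
  constructor
  · rintro ⟨h1, h2, h3⟩
    refine ⟨⟨h1, rfl⟩, h2, fun α u hα hu => ?_⟩
    obtain ⟨z, γ, rfl⟩ := exists_comp_arrow hα hu
    exact h3 z γ
  · rintro ⟨⟨h1, -⟩, h2, h3⟩
    exact ⟨h1, h2, fun z γ => h3 (arrow γ) _ rfl (comp?_mk _ _)⟩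

theorem isMaximalTo_iff {x : V} {w : QPath V} : IsMaximalTo I x w ↔
    comp? w (nil x) = some w ∧ IsMaximalPath (flip comp?) (IsNonzeroPath I) w := by
  rw [comp?_nil_iff, IsMaximalTo, IsMaximalPath]
  constructor
  · rintro ⟨h1, h2, h3⟩
    refine ⟨⟨h1, rfl⟩, h2, fun α u hα hu => ?_⟩
    obtain ⟨z, γ, rfl⟩ := exists_arrow_comp hα hu
    exact h3 z γ
  · rintro ⟨⟨h1, -⟩, h2, h3⟩
    exact ⟨h1, h2, fun z γ => h3 (arrow γ) _ rfl (comp?_mk _ _)⟩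

theorem isRightMaximalPair_iff {p w₀ : QPath V} {w₁ : Option (QPath V)} :
    IsRightMaximalPair I p w₀ w₁ ↔
      IsMaximalPair comp? (IsNonzeroPath I) (nil p.src) p w₀ w₁ := by
  constructor
  · rintro ⟨h1, h2, h3⟩
    exact ⟨isPrefix_iff.mp h1, h2, fun w => isMaximalFrom_iff.symm.trans (h3 w)⟩
  · rintro ⟨h1, h2, h3⟩
    exact ⟨isPrefix_iff.mpr h1, h2, fun w => isMaximalFrom_iff.trans (h3 w)⟩

theorem isLeftMaximalPair_iff {p w₀ : QPath V} {w₁ : Option (QPath V)} :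
    IsLeftMaximalPair I p w₀ w₁ ↔
      IsMaximalPair (flip comp?) (IsNonzeroPath I) (nil p.tgt) p w₀ w₁ := by
  constructor
  · rintro ⟨h1, h2, h3⟩
    exact ⟨isSuffix_iff.mp h1, h2, fun w => isMaximalTo_iff.symm.trans (h3 w)⟩
  · rintro ⟨h1, h2, h3⟩
    exact ⟨isSuffix_iff.mpr h1, h2, fun w => isMaximalTo_iff.trans (h3 w)⟩

theorem isRightMaximalSequence_iff {p : QPath V} {s : List (Fin 2) → Option (QPath V)} :
    IsRightMaximalSequence I p s ↔ s [] = some p ∧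
      (∀ t, s t = none → ∀ i : Fin 2, s (t ++ [i]) = none) ∧
      ∀ t q, s t = some q →
        IsStep comp? (IsNonzeroPath I) (nil q.src) q fun i => s (t ++ [i]) := by
  simp only [IsStep, ← isRightMaximalPair_iff, ← isRightRemainder_iff]
  exact ⟨fun h => ⟨h.start, h.of_none, h.step⟩, fun h => ⟨h.1, h.2.1, h.2.2⟩⟩

theorem isLeftMaximalSequence_iff {p : QPath V} {s : List (Fin 2) → Option (QPath V)} :
    IsLeftMaximalSequence I p s ↔ s [] = some p ∧
      (∀ t, s t = none → ∀ i : Fin 2, s (t ++ [i]) = none) ∧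
      ∀ t q, s t = some q →
        IsStep (flip comp?) (IsNonzeroPath I) (nil q.tgt) q fun i => s (t ++ [i]) := by
  simp only [IsStep, ← isLeftMaximalPair_iff, ← isLeftRemainder_iff]
  exact ⟨fun h => ⟨h.start, h.of_none, h.step⟩, fun h => ⟨h.1, h.2.1, h.2.2⟩⟩

end NonzeroPaths

section Sequences

variable {V : Type u} [Quiver.{u} V] {m : QPath V → QPath V → Option (QPath V)}
  {N : QPath V → Prop} {e : QPath V → QPath V}

/-- All paths that occur in a maximal sequence of a non-zero path are non-zero. -/
theorem IsStringLike.nonzero_of_sequence (h : IsStringLike m N)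
    (he : ∀ q, (e q).length = 0 ∧ m (e q) q = some q)
    {p : QPath V} (hp : N p) {s : List (Fin 2) → Option (QPath V)} (hs : s [] = some p)
    (hnone : ∀ t, s t = none → ∀ i : Fin 2, s (t ++ [i]) = none)
    (hstep : ∀ t q, s t = some q → IsStep m N (e q) q fun i => s (t ++ [i]))
    (t : List (Fin 2)) (q : QPath V) (hq : s t = some q) : N q := by
  induction t using List.reverseRecOn generalizing q with
  | nil => exact Option.some.inj (hs.symm.trans hq) ▸ hp
  | append_singleton t i ih =>
    cases ht : s t with
    | none =>
      rw [hnone t ht i] at hq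
      cases hq
    | some q₀ =>
      obtain ⟨a, ha⟩ := h.exists_isBranching (he q₀).1 (he q₀).2 (hstep t q₀ ht)
      obtain ⟨w, hw, hNw⟩ := ha.nonzero (i := i) hq
      exact h.right hw hNw

theorem IsStringLike.exists_sequence (h : IsStringLike m N)
    (he : ∀ q, (e q).length = 0 ∧ m (e q) q = some q) {p : QPath V} (hp : N p) :
    ∃ s : List (Fin 2) → Option (QPath V), s [] = some p ∧
      (∀ t, s t = none → ∀ i : Fin 2, s (t ++ [i]) = none) ∧
      ∀ t q, s t = some q → IsStep m N (e q) q fun i => s (t ++ [i]) := by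
  choose! f hf using fun q (hq : N q) => h.exists_isStep (he q).1 (he q).2 hq
  let s : List (Fin 2) → Option (QPath V) := fun t =>
    t.foldl (fun o i => o.bind fun q => f q i) (some p)
  have hsucc : ∀ t i, s (t ++ [i]) = (s t).bind fun q => f q i := fun t i => by
    simp only [s, List.foldl_append, List.foldl_cons, List.foldl_nil]
  have hN : ∀ t q, s t = some q → N q := by
    intro t
    induction t using List.reverseRecOn with
    | nil => exact fun q hq => Option.some.inj hq ▸ hp
    | append_singleton t i ih =>
      intro q hq
      rw [hsucc] at hq
      obtain ⟨q₀, hq₀, hq⟩ := Option.bind_eq_some_iff.mp hq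
      obtain ⟨a, ha⟩ := h.exists_isBranching (he q₀).1 (he q₀).2 (hf q₀ (ih q₀ hq₀))
      obtain ⟨w, hw, hNw⟩ := ha.nonzero hq
      exact h.right hw hNw
  refine ⟨s, rfl, fun t ht i => by rw [hsucc, ht, Option.bind_none], fun t q hq => ?_⟩
  have : (fun i => s (t ++ [i])) = f q := funext fun i => by rw [hsucc, hq, Option.bind_some]
  rw [this]
  exact hf q (hN t q hq)

end Sequences

/-! ### Modules over the bound quiver algebra -/

section Algebra

open QPath

variable {k V : Type u} [Field k] [Quiver.{u} V] [Fintype V]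

/-- The class of a path in `A = kQ/I`. -/
def pathClass (I : TwoSidedIdeal (PathAlgebra k V)) (p : QPath V) : BoundAlg I :=
  I.ringCon.mk' (PathAlgebra.ofPath k p)

variable {I : TwoSidedIdeal (PathAlgebra k V)}

theorem pathClass_mul {p q u : QPath V} (h : comp? p q = some u) :
    pathClass I p * pathClass I q = pathClass I u := by
  rw [pathClass, pathClass, ← map_mul, ofPath_mul_of_comp? h]
  rfl

theorem pathClass_mul_of_none {p q : QPath V} (h : comp? p q = none) :
    pathClass I p * pathClass I q = 0 := by
  rw [pathClass, pathClass, ← map_mul, PathAlgebra.ofPath_mul_ofPath, h]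
  exact map_zero _

theorem pathClass_eq_zero_iff {p : QPath V} : pathClass I p = 0 ↔ ¬ IsNonzeroPath I p := by
  rw [IsNonzeroPath, not_not, TwoSidedIdeal.mem_iff]
  exact RingCon.eq I.ringCon

theorem pathClass_eq_zero {p : QPath V} (h : ¬ IsNonzeroPath I p) : pathClass I p = 0 :=
  pathClass_eq_zero_iff.mpr h

theorem pathClass_nil_mul_nil (x : V) :
    pathClass I (nil x) * pathClass I (nil x) = pathClass I (nil x) :=
  pathClass_mul (nil_comp?_iff.mpr ⟨rfl, rfl⟩)

theorem sum_pathClass_nil : ∑ x : V, pathClass I (nil x) = 1 := by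
  have h1 : (1 : PathAlgebra k V) = ∑ x : V, PathAlgebra.ofPath k (nil x) := rfl
  rw [← map_one I.ringCon.mk', h1, map_sum]
  rfl

variable (I) in
/-- The projection `kQ → A` as a linear map. -/
def mkLinear : PathAlgebra k V →ₗ[k] BoundAlg I where
  toFun := I.ringCon.mk'
  map_add' := map_add _
  map_smul' _ _ := rfl

theorem mkLinear_surjective : Function.Surjective (mkLinear I) := RingCon.mk'_surjective _

theorem boundAlg_hom_ext {M : Type u} [AddCommMonoid M] [Module k M] {f g : BoundAlg I →ₗ[k] M}
    (h : ∀ p, f (pathClass I p) = g (pathClass I p)) : f = g := by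
  have h1 : f ∘ₗ mkLinear I = g ∘ₗ mkLinear I := PathAlgebra.hom_ext h
  refine LinearMap.ext fun a => ?_
  obtain ⟨b, rfl⟩ := mkLinear_surjective a
  exact LinearMap.congr_fun h1 b

/-- The action of a path on a right `A`-module. -/
def pathAct {X : Type u} [AddCommGroup X] [Module (BoundAlg I)ᵐᵒᵖ X] (q : QPath V) (x : X) : X :=
  MulOpposite.op (pathClass I q) • x

section PathAct

variable {X Y : Type u} [AddCommGroup X] [Module (BoundAlg I)ᵐᵒᵖ X]
  [AddCommGroup Y] [Module (BoundAlg I)ᵐᵒᵖ Y]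

theorem pathAct_pathAct {p q u : QPath V} (h : comp? p q = some u) (x : X) :
    pathAct (I := I) q (pathAct (I := I) p x) = pathAct (I := I) u x := by
  rw [pathAct, pathAct, ← mul_smul, ← MulOpposite.op_mul, pathClass_mul h, pathAct]

theorem pathAct_pathAct_of_none {p q : QPath V} (h : comp? p q = none) (x : X) :
    pathAct (I := I) q (pathAct (I := I) p x) = 0 := by
  rw [pathAct, pathAct, ← mul_smul, ← MulOpposite.op_mul, pathClass_mul_of_none h,
    MulOpposite.op_zero, zero_smul]

theorem pathAct_eq_zero {q : QPath V} (h : ¬ IsNonzeroPath I q) (x : X) :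
    pathAct (I := I) q x = 0 := by
  rw [pathAct, pathClass_eq_zero h, MulOpposite.op_zero, zero_smul]

theorem sum_pathAct_nil (x : X) : ∑ v : V, pathAct (I := I) (nil v) x = x := by
  simp only [pathAct]
  rw [← Finset.sum_smul, ← Finset.op_sum, sum_pathClass_nil, MulOpposite.op_one, one_smul]

/-- A `k`-linear map that commutes with the action of the paths is `A`-linear. -/
def linearMapOfPaths [Module k X] [IsScalarTower k (BoundAlg I)ᵐᵒᵖ X] [Module k Y]
    [IsScalarTower k (BoundAlg I)ᵐᵒᵖ Y] (f : X →ₗ[k] Y)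
    (hf : ∀ q x, f (pathAct (I := I) q x) = pathAct (I := I) q (f x)) :
    X →ₗ[(BoundAlg I)ᵐᵒᵖ] Y where
  toFun := f
  map_add' := map_add f
  map_smul' a x := by
    let g₁ : BoundAlg I →ₗ[k] Y :=
      { toFun := fun a => f (MulOpposite.op a • x)
        map_add' := fun a b => by rw [MulOpposite.op_add, add_smul, map_add]
        map_smul' := fun c a => by
          rw [MulOpposite.op_smul, smul_assoc, map_smul, RingHom.id_apply] }
    let g₂ : BoundAlg I →ₗ[k] Y :=
      { toFun := fun a => MulOpposite.op a • f x
        map_add' := fun a b => by rw [MulOpposite.op_add, add_smul]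
        map_smul' := fun c a => by rw [MulOpposite.op_smul, smul_assoc, RingHom.id_apply] }
    have h : g₁ = g₂ := boundAlg_hom_ext fun q => hf q x
    exact LinearMap.congr_fun h a.unop

variable (I) in
/-- The additive subgroup of `X` generated by the elements `x q` where `q` is a path of length at
least `n`: the `n`-th power of the radical of `X`. -/
def radPow (X : Type u) [AddCommGroup X] [Module (BoundAlg I)ᵐᵒᵖ X] (n : ℕ) : AddSubgroup X :=
  AddSubgroup.closure {y | ∃ (q : QPath V) (x : X), n ≤ q.length ∧ y = pathAct (I := I) q x}

theorem pathAct_mem_radPow {q : QPath V} {n : ℕ} (hq : n ≤ q.length) (x : X) :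
    pathAct (I := I) q x ∈ radPow I X n :=
  AddSubgroup.subset_closure ⟨q, x, hq, rfl⟩

theorem map_mem_radPow (f : X →ₗ[(BoundAlg I)ᵐᵒᵖ] Y) {n : ℕ} {x : X} (hx : x ∈ radPow I X n) :
    f x ∈ radPow I Y n := by
  have hle : radPow I X n ≤ (radPow I Y n).comap f.toAddMonoidHom := by
    rw [radPow, AddSubgroup.closure_le]
    rintro _ ⟨q, x, hq, rfl⟩
    change f (MulOpposite.op (pathClass I q) • x) ∈ radPow I Y n
    rw [map_smul]
    exact pathAct_mem_radPow hq (f x)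
  exact hle hx

theorem pathAct_mem_radPow_add {q : QPath V} {x : X} {n : ℕ} (hx : x ∈ radPow I X n) :
    pathAct (I := I) q x ∈ radPow I X (n + q.length) := by
  have hle : radPow I X n ≤
      (radPow I X (n + q.length)).comap (DistribSMul.toAddMonoidHom X
        (MulOpposite.op (pathClass I q))) := by
    rw [radPow, AddSubgroup.closure_le]
    rintro _ ⟨r, x, hr, rfl⟩
    change pathAct q (pathAct r x) ∈ radPow I X (n + q.length)
    cases h : comp? r q with
    | none =>
      rw [pathAct_pathAct_of_none h]
      exact AddSubgroup.zero_mem _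
    | some u =>
      rw [pathAct_pathAct h]
      refine pathAct_mem_radPow ?_ x
      have := isConcat_comp?.length h
      omega
  exact hle hx

/-- Nakayama's lemma: the radical of `A` is nilpotent, so a submodule of the radical of `X` is
superfluous. -/
theorem isSuperfluous_of_le_radPow (hI : IsStringPresentation I)
    {N : Submodule (BoundAlg I)ᵐᵒᵖ X} (hN : ∀ x ∈ N, x ∈ radPow I X 1) : IsSuperfluous N := by
  intro L hL
  have key : ∀ n x, x ∈ L.toAddSubgroup ⊔ radPow I X (n + 1) := by
    have h0 : ∀ x : X, ∃ y ∈ L, ∃ z ∈ radPow I X 1, y + z = x := fun x => by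
      obtain ⟨z, hz, y, hy, h⟩ := Submodule.mem_sup.mp (hL.ge (Submodule.mem_top (x := x)))
      exact ⟨y, hy, z, hN z hz, by rw [add_comm, h]⟩
    intro n
    induction n with
    | zero =>
      intro x
      obtain ⟨y, hy, z, hz, rfl⟩ := h0 x
      exact AddSubgroup.mem_sup.mpr ⟨y, hy, z, hz, rfl⟩
    | succ n ih =>
      have hle : L.toAddSubgroup ⊔ radPow I X (n + 1) ≤
          L.toAddSubgroup ⊔ radPow I X (n + 1 + 1) := by
        refine sup_le le_sup_left ?_
        conv_lhs => rw [radPow]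
        rw [AddSubgroup.closure_le]
        rintro _ ⟨q, x, hq, rfl⟩
        obtain ⟨y, hy, z, hz, rfl⟩ := h0 x
        refine AddSubgroup.mem_sup.mpr ⟨pathAct q y, L.smul_mem _ hy, pathAct q z, ?_,
          (smul_add _ _ _).symm⟩
        have hmono : radPow I X (1 + q.length) ≤ radPow I X (n + 1 + 1) :=
          AddSubgroup.closure_mono fun _ ⟨r, w, hr, h⟩ => ⟨r, w, by omega, h⟩
        exact hmono (pathAct_mem_radPow_add hz)
      exact fun x => hle (ih x)
  obtain ⟨B, hB⟩ := hI.exists_length_bound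
  have hbot : radPow I X (B + 1) = ⊥ := by
    rw [eq_bot_iff, radPow, AddSubgroup.closure_le]
    rintro _ ⟨q, x, hq, rfl⟩
    exact pathAct_eq_zero (fun h => absurd (hB q h) (by omega)) x
  refine eq_top_iff.mpr fun x _ => ?_
  have := key B x
  rwa [hbot, sup_bot_eq] at this

/-- A submodule is essential if it contains the socle, which consists of the elements that are
annihilated by all arrows. -/
theorem isEssential_of_socle_le (hI : IsStringPresentation I) {N : Submodule (BoundAlg I)ᵐᵒᵖ X}
    (hN : ∀ x : X, (∀ α : QPath V, α.length = 1 → pathAct (I := I) α x = 0) → x ∈ N) :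
    IsEssential N := by
  intro L hL
  have key : ∀ n, ∀ x ∈ L, (∀ q : QPath V, n ≤ q.length → pathAct (I := I) q x = 0) → x = 0 := by
    intro n
    induction n with
    | zero =>
      intro x _ hx
      rw [← sum_pathAct_nil (I := I) x]
      exact Finset.sum_eq_zero fun v _ => hx _ (Nat.zero_le _)
    | succ n ih =>
      intro x hxL hx
      refine ih x hxL fun q hq => ?_
      have hmem : pathAct (I := I) q x ∈ N ⊓ L := by
        refine ⟨hN _ fun α hα => ?_, L.smul_mem _ hxL⟩
        cases h : comp? q α with
        | none => exact pathAct_pathAct_of_none h x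
        | some u =>
          rw [pathAct_pathAct h]
          have := isConcat_comp?.length h
          exact hx u (by omega)
      rw [hL] at hmem
      exact hmem
  obtain ⟨B, hB⟩ := hI.exists_length_bound
  refine eq_bot_iff.mpr fun x hx => ?_
  exact key (B + 1) x hx fun q hq =>
    pathAct_eq_zero (fun h => absurd (hB q h) (by omega)) x

end PathAct

/-! ### Coordinates in the string modules and in the algebra -/

section PathModule

variable (hI : IsMonomial I) {p : QPath V} (hp : IsNonzeroPath I p)

instance : Module k (PathModule hI hp) := inferInstanceAs (Module k (PathSpace k p))

theorem pathAct_pathModule (q : QPath V) (v : PathModule hI hp) :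
    pathAct (I := I) q v = PathSpace.act k p q v := by
  change (PathSpace.actLinear k p (PathAlgebra.ofPath k q)).unop v = _
  rw [PathSpace.actLinear, PathAlgebra.lift_ofPath, MulOpposite.unop_op]

instance : IsScalarTower k (BoundAlg I)ᵐᵒᵖ (PathModule hI hp) where
  smul_assoc c a v := by
    obtain ⟨a⟩ := a
    obtain ⟨b, rfl⟩ := mkLinear_surjective a
    change (PathSpace.actLinear k p (c • b)).unop v = c • (PathSpace.actLinear k p b).unop v
    rw [map_smul]
    rfl

/-- The basis vector of `M(p)` belonging to `w` if `w` is an initial subpath of `p`, and `0`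
otherwise. -/
def pathVec (w : QPath V) : PathModule hI hp := PathSpace.vec k p (some w)

theorem pathVec_eq_zero {w : QPath V} (hw : ¬ w.IsPrefix p) : pathVec hI hp w = 0 :=
  dif_neg hw

theorem pathAct_pathVec {w q u : QPath V} (h : comp? w q = some u) :
    pathAct (I := I) q (pathVec hI hp w) = pathVec hI hp u := by
  rw [pathAct_pathModule]
  refine (PathSpace.act_vec q (some w)).trans ?_
  rw [Option.bind_some, h]
  rfl

theorem pathAct_pathVec_of_none {w q : QPath V} (h : comp? w q = none) :
    pathAct (I := I) q (pathVec hI hp w) = 0 := by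
  rw [pathAct_pathModule]
  refine (PathSpace.act_vec q (some w)).trans ?_
  rw [Option.bind_some, h]
  rfl

theorem pathModule_hom_ext {M : Type u} [AddCommMonoid M] [Module k M]
    {f g : PathModule hI hp →ₗ[k] M}
    (h : ∀ w : QPath V, w.IsPrefix p → f (pathVec hI hp w) = g (pathVec hI hp w)) : f = g := by
  refine Finsupp.lhom_ext' fun w => LinearMap.ext_ring ?_
  have := h w.1 w.2
  rwa [pathVec, PathSpace.vec, dif_pos w.2] at this

/-- The `k`-linear map on `M(p)` with prescribed values on the basis. -/
def pathModuleLift {M : Type u} [AddCommMonoid M] [Module k M] (f : QPath V → M) :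
    PathModule hI hp →ₗ[k] M :=
  Finsupp.linearCombination k fun w : {w : QPath V // w.IsPrefix p} => f w.1

theorem pathModuleLift_pathVec {M : Type u} [AddCommMonoid M] [Module k M] (f : QPath V → M)
    {w : QPath V} (hw : w.IsPrefix p) : pathModuleLift hI hp f (pathVec hI hp w) = f w := by
  rw [pathVec, PathSpace.vec, dif_pos hw]
  exact (Finsupp.linearCombination_single k 1 _).trans (one_smul k _)

open Classical in
/-- The coordinate of an element of `M(p)` at the basis vector belonging to `u`. -/
def pathCoord (u : QPath V) : PathModule hI hp →ₗ[k] k :=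
  pathModuleLift hI hp fun w => if w = u then 1 else 0

theorem pathCoord_self {u : QPath V} (hu : u.IsPrefix p) :
    pathCoord hI hp u (pathVec hI hp u) = 1 := by
  rw [pathCoord, pathModuleLift_pathVec _ _ _ hu, if_pos rfl]

theorem pathCoord_of_ne {u w : QPath V} (h : w ≠ u) :
    pathCoord hI hp u (pathVec hI hp w) = 0 := by
  by_cases hw : w.IsPrefix p
  · rw [pathCoord, pathModuleLift_pathVec _ _ _ hw, if_neg h]
  · rw [pathVec_eq_zero _ _ hw, map_zero]

theorem mem_span_pathVec (v : PathModule hI hp) :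
    v ∈ Submodule.span k (pathVec hI hp '' {w | w.IsPrefix p ∧ pathCoord hI hp w v ≠ 0}) := by
  have hcoord : ∀ w : {w : QPath V // w.IsPrefix p}, pathCoord hI hp w.1 v
      = (show PathSpace k p from v) w := by
    intro w
    have : pathCoord hI hp w.1 = Finsupp.lapply w := by
      refine Finsupp.lhom_ext' fun w' => LinearMap.ext_ring ?_
      change pathCoord hI hp w.1 (Finsupp.single w' 1) = (Finsupp.single w' 1 : PathSpace k p) w
      have h1 : (Finsupp.single w' 1 : PathSpace k p) = pathVec hI hp w'.1 := by
        rw [pathVec, PathSpace.vec, dif_pos w'.2]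
      by_cases h : w' = w
      · subst h
        rw [Finsupp.single_eq_same, h1]
        exact pathCoord_self hI hp w'.2
      · rw [Finsupp.single_eq_of_ne' h, h1]
        exact pathCoord_of_ne hI hp fun h' => h (Subtype.ext h')
    rw [this]
    rfl
  have hsum : v = ∑ w ∈ (show PathSpace k p from v).support,
      (show PathSpace k p from v) w • pathVec hI hp w.1 := by
    conv_lhs => rw [← Finsupp.sum_single (show PathSpace k p from v)]
    refine Finset.sum_congr rfl fun w _ => ?_
    rw [pathVec, PathSpace.vec, dif_pos w.2, ← Finsupp.smul_single_one]
    rfl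
  rw [hsum]
  refine Submodule.sum_mem _ fun w hw => Submodule.smul_mem _ _ (Submodule.subset_span
    ⟨w.1, ⟨w.2, ?_⟩, rfl⟩)
  rw [← hsum, hcoord]
  exact Finsupp.mem_support_iff.mp hw

end PathModule

/-- Acting on a fixed element of a right module. -/
def evalAt {X : Type u} [AddCommGroup X] [Module (BoundAlg I)ᵐᵒᵖ X] (x : X) :
    BoundAlg I →ₗ[(BoundAlg I)ᵐᵒᵖ] X where
  toFun a := MulOpposite.op a • x
  map_add' a b := by rw [MulOpposite.op_add, add_smul]
  map_smul' a b := by rw [RingHom.id_apply, ← mul_smul]; rfl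

open Classical in
/-- The coefficient of the path `u` in an element of `A`. If `u` is non-zero then it can be read
off from the action on the string module of `u`; if `u` is zero then we put it to be `0`. -/
def coeff (hI : IsMonomial I) (u : QPath V) : BoundAlg I →ₗ[k] k :=
  if hu : IsNonzeroPath I u then
    pathCoord hI hu u ∘ₗ (evalAt (pathVec hI hu (nil u.src))).restrictScalars k
  else 0

section Coeff

variable (hI : IsMonomial I)

theorem evalAt_pathVec {p : QPath V} (hp : IsNonzeroPath I p) (w : QPath V) {x : V}
    (hw : w.src = x) : evalAt (pathVec hI hp (nil x)) (pathClass I w) = pathVec hI hp w :=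
  pathAct_pathVec hI hp (nil_comp?_iff.mpr ⟨hw, rfl⟩)

theorem evalAt_pathVec_of_ne {p : QPath V} (hp : IsNonzeroPath I p) (w : QPath V) {x : V}
    (hw : w.src ≠ x) : evalAt (pathVec hI hp (nil x)) (pathClass I w) = 0 :=
  pathAct_pathVec_of_none hI hp (comp?_of_ne (Ne.symm hw))

theorem coeff_self {u : QPath V} (hu : IsNonzeroPath I u) : coeff hI u (pathClass I u) = 1 := by
  rw [coeff, dif_pos hu, LinearMap.comp_apply, LinearMap.restrictScalars_apply,
    evalAt_pathVec hI hu u rfl, pathCoord_self hI hu (isPrefix_refl u)]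

theorem coeff_of_ne {u w : QPath V} (h : w ≠ u) : coeff hI u (pathClass I w) = 0 := by
  by_cases hu : IsNonzeroPath I u
  · rw [coeff, dif_pos hu, LinearMap.comp_apply, LinearMap.restrictScalars_apply]
    by_cases hw : w.src = u.src
    · rw [evalAt_pathVec hI hu w hw, pathCoord_of_ne hI hu h]
    · rw [evalAt_pathVec_of_ne hI hu w hw, map_zero]
  · rw [coeff, dif_neg hu, LinearMap.zero_apply]

theorem coeff_mkLinear {u : QPath V} (hu : IsNonzeroPath I u) (b : PathAlgebra k V) :
    coeff hI u (mkLinear I b) = (show QPath V →₀ k from b) u := by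
  have h : coeff hI u ∘ₗ mkLinear I = (Finsupp.lapply u : (QPath V →₀ k) →ₗ[k] k) := by
    refine PathAlgebra.hom_ext fun w => ?_
    change coeff hI u (pathClass I w) = (Finsupp.single w 1 : QPath V →₀ k) u
    by_cases hw : w = u
    · subst hw
      rw [coeff_self hI hu, Finsupp.single_eq_same]
    · rw [coeff_of_ne hI hw, Finsupp.single_eq_of_ne' hw]
  exact LinearMap.congr_fun h b

/-- Because `I` is generated by paths, every element of `A` is a combination of the non-zero paths
with the coefficients `coeff`. -/
theorem mem_span_pathClass (a : BoundAlg I) :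
    a ∈ Submodule.span k (pathClass I '' {u | IsNonzeroPath I u ∧ coeff hI u a ≠ 0}) := by
  obtain ⟨b, rfl⟩ := mkLinear_surjective a
  have hsum : mkLinear I b = ∑ w ∈ (show QPath V →₀ k from b).support,
      (show QPath V →₀ k from b) w • pathClass I w := by
    have h1 : b = ∑ w ∈ (show QPath V →₀ k from b).support,
        (show QPath V →₀ k from b) w • PathAlgebra.ofPath k w := by
      conv_lhs => rw [← Finsupp.sum_single (show QPath V →₀ k from b)]
      refine Finset.sum_congr rfl fun w _ => ?_
      rw [← Finsupp.smul_single_one]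
      rfl
    conv_lhs => rw [h1]
    rw [map_sum]
    rfl
  rw [hsum]
  refine Submodule.sum_mem _ fun w hw => ?_
  by_cases hN : IsNonzeroPath I w
  · refine Submodule.smul_mem _ _ (Submodule.subset_span ⟨w, ⟨hN, ?_⟩, rfl⟩)
    rw [← hsum, coeff_mkLinear hI hN]
    exact Finsupp.mem_support_iff.mp hw
  · rw [pathClass_eq_zero hN, smul_zero]
    exact Submodule.zero_mem _

end Coeff

end Algebra

/-! ### The projective cover of a string module and its kernel -/

/-- The indices `i` for which the successor `f i` exists. -/
abbrev Successor {V : Type u} [Quiver.{u} V] (f : Fin 2 → Option (QPath V)) : Type :=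
  {i : Fin 2 // (f i).isSome}

/-- The successor with a given index. -/
def Successor.path {V : Type u} [Quiver.{u} V] {f : Fin 2 → Option (QPath V)} (i : Successor f) :
    QPath V := (f i.1).get i.2

theorem Successor.eq_some {V : Type u} [Quiver.{u} V] {f : Fin 2 → Option (QPath V)}
    (i : Successor f) : f i.1 = some i.path := (Option.some_get i.2).symm

section ProjectiveCover

open QPath

variable {k V : Type u} [Field k] [Quiver.{u} V] [Fintype V] {I : TwoSidedIdeal (PathAlgebra k V)}

theorem smul_mem_radPow {X : Type u} [AddCommGroup X] [Module (BoundAlg I)ᵐᵒᵖ X] [Module k X]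
    [IsScalarTower k (BoundAlg I)ᵐᵒᵖ X] (c : k) {n : ℕ} {x : X} (hx : x ∈ radPow I X n) :
    c • x ∈ radPow I X n := by
  have := IsScalarTower.to_smulCommClass (R := k) (A := (BoundAlg I)ᵐᵒᵖ) (M := X)
  have hle : radPow I X n ≤ (radPow I X n).comap (DistribSMul.toAddMonoidHom X c) := by
    conv_lhs => rw [radPow]
    rw [AddSubgroup.closure_le]
    rintro _ ⟨q, x, hq, rfl⟩
    change c • (MulOpposite.op (pathClass I q) • x) ∈ radPow I X n
    rw [smul_comm]
    exact pathAct_mem_radPow hq _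
  exact hle hx

theorem IsNonzeroPath.of_isPrefix {w p : QPath V} (hp : IsNonzeroPath I p) (hw : w.IsPrefix p) :
    IsNonzeroPath I w := by
  obtain ⟨r, hr⟩ := isPrefix_iff.mp hw
  exact hp.left hr

/-- A `k`-linear map on a string module that commutes with the action of the paths on the basis
vectors is `A`-linear. -/
theorem map_pathAct_of_pathVec (hI : IsMonomial I) {p : QPath V} (hp : IsNonzeroPath I p)
    {Y : Type u} [AddCommGroup Y] [Module (BoundAlg I)ᵐᵒᵖ Y] [Module k Y]
    [IsScalarTower k (BoundAlg I)ᵐᵒᵖ Y] (f : PathModule hI hp →ₗ[k] Y)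
    (hf : ∀ q w, w.IsPrefix p → f (pathAct (I := I) q (pathVec hI hp w))
      = pathAct (I := I) q (f (pathVec hI hp w))) (q : QPath V) (v : PathModule hI hp) :
    f (pathAct (I := I) q v) = pathAct (I := I) q (f v) := by
  have h : f ∘ₗ Algebra.lsmul k k (PathModule hI hp) (MulOpposite.op (pathClass I q))
      = Algebra.lsmul k k Y (MulOpposite.op (pathClass I q)) ∘ₗ f :=
    pathModule_hom_ext hI hp fun w hw => hf q w hw
  exact LinearMap.congr_fun h v

theorem eq_zero_of_pathCoord (hI : IsMonomial I) {p : QPath V} (hp : IsNonzeroPath I p)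
    {v : PathModule hI hp} (hv : ∀ w : QPath V, w.IsPrefix p → pathCoord hI hp w v = 0) :
    v = 0 := by
  have h := mem_span_pathVec hI hp v
  have h0 : {w : QPath V | w.IsPrefix p ∧ pathCoord hI hp w v ≠ 0} = ∅ :=
    Set.eq_empty_of_forall_notMem fun w hw => hw.2 (hv w hw.1)
  rwa [h0, Set.image_empty, Submodule.span_empty, Submodule.mem_bot] at h

theorem mem_projAt {x : V} {y : BoundAlg I} :
    y ∈ (Submodule.span (BoundAlg I)ᵐᵒᵖ {idem I x} : Submodule (BoundAlg I)ᵐᵒᵖ (BoundAlg I)) ↔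
      pathClass I (nil x) * y = y := by
  rw [Submodule.mem_span_singleton]
  constructor
  · rintro ⟨a, rfl⟩
    change pathClass I (nil x) * (pathClass I (nil x) * a.unop) = pathClass I (nil x) * a.unop
    rw [← mul_assoc, pathClass_nil_mul_nil]
  · intro h
    exact ⟨MulOpposite.op y, h⟩

theorem pathClass_mem_projAt {x : V} {u : QPath V} (hu : u.src = x) :
    pathClass I u ∈
      (Submodule.span (BoundAlg I)ᵐᵒᵖ {idem I x} : Submodule (BoundAlg I)ᵐᵒᵖ (BoundAlg I)) :=
  mem_projAt.mpr (pathClass_mul (nil_comp?_iff.mpr ⟨hu, rfl⟩))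

/-- The generator `e_x` of `P(x)`. -/
def projGen (I : TwoSidedIdeal (PathAlgebra k V)) (x : V) : ProjAt I x :=
  ⟨idem I x, Submodule.mem_span_singleton_self _⟩

theorem op_smul_projGen {x : V} (y : ProjAt I x) : MulOpposite.op y.1 • projGen I x = y :=
  Subtype.ext (mem_projAt.mp y.2)

instance projective_projAt (x : V) : Module.Projective (BoundAlg I)ᵐᵒᵖ (ProjAt I x) := by
  refine Module.Projective.of_lifting_property'' fun f hf => ?_
  obtain ⟨n, hn⟩ := hf (projGen I x)
  refine ⟨evalAt n ∘ₗ Submodule.subtype _, LinearMap.ext fun y => ?_⟩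
  change f (MulOpposite.op y.1 • n) = y
  rw [map_smul, hn, op_smul_projGen]

theorem coeff_eq_zero_of_mem_projAt (hI : IsMonomial I) {x : V} (y : ProjAt I x) {u : QPath V}
    (hu : u.src ≠ x) : coeff hI u y.1 = 0 := by
  have h : coeff hI u ∘ₗ LinearMap.mulLeft k (pathClass I (nil x)) = 0 := by
    refine boundAlg_hom_ext fun w => ?_
    rw [LinearMap.comp_apply, LinearMap.mulLeft_apply, LinearMap.zero_apply]
    cases hw : comp? (nil x) w with
    | none => rw [pathClass_mul_of_none hw, map_zero]
    | some v =>
      rw [pathClass_mul hw]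
      refine coeff_of_ne hI fun hvu => hu ?_
      rw [← hvu, comp?_src hw]
      rfl
  have := LinearMap.congr_fun h y.1
  rwa [LinearMap.comp_apply, LinearMap.mulLeft_apply, mem_projAt.mp y.2] at this

variable (hI : IsMonomial I) {q : QPath V} (hq : IsNonzeroPath I q)

/-- The projective cover `P(x) → M(q)` of the string module of a path `q` starting at `x`. -/
def projCover : ProjAt I q.src →ₗ[(BoundAlg I)ᵐᵒᵖ] PathModule hI hq :=
  evalAt (pathVec hI hq (nil q.src)) ∘ₗ Submodule.subtype _

theorem projCover_surjective : Function.Surjective (projCover hI hq) := by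
  intro v
  have hle : Submodule.span k (pathVec hI hq '' {w | w.IsPrefix q ∧ pathCoord hI hq w v ≠ 0}) ≤
      LinearMap.range ((projCover hI hq).restrictScalars k) := by
    rw [Submodule.span_le]
    rintro _ ⟨w, ⟨hw, -⟩, rfl⟩
    exact ⟨⟨pathClass I w, pathClass_mem_projAt (src_eq_of_isPrefix hw)⟩,
      evalAt_pathVec hI hq w (src_eq_of_isPrefix hw)⟩
  exact hle (mem_span_pathVec hI hq v)

theorem pathCoord_evalAt {u : QPath V} (hu : u.IsPrefix q) (a : BoundAlg I) :
    pathCoord hI hq u (evalAt (pathVec hI hq (nil q.src)) a) = coeff hI u a := by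
  have h : pathCoord hI hq u ∘ₗ (evalAt (I := I) (pathVec hI hq (nil q.src))).restrictScalars k
      = coeff hI u := by
    refine boundAlg_hom_ext fun w => ?_
    rw [LinearMap.comp_apply, LinearMap.restrictScalars_apply]
    by_cases hw : w = u
    · subst hw
      rw [evalAt_pathVec hI hq w (src_eq_of_isPrefix hu), pathCoord_self hI hq hu,
        coeff_self hI (hq.of_isPrefix hu)]
    · rw [coeff_of_ne hI hw]
      by_cases hs : w.src = q.src
      · rw [evalAt_pathVec hI hq w hs, pathCoord_of_ne hI hq hw]
      · rw [evalAt_pathVec_of_ne hI hq w hs, map_zero]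
  exact LinearMap.congr_fun h a

/-- The kernel of the projective cover is spanned by the non-zero paths starting at the source
of `q` that are not initial subpaths of `q`. -/
theorem mem_span_of_mem_ker {y : ProjAt I q.src} (hy : projCover hI hq y = 0) :
    y.1 ∈ Submodule.span k
      (pathClass I '' {u | IsNonzeroPath I u ∧ u.src = q.src ∧ ¬ u.IsPrefix q}) := by
  refine Submodule.span_mono (Set.image_mono ?_) (mem_span_pathClass hI y.1)
  rintro u ⟨hu, hc⟩
  refine ⟨hu, ?_, fun hpre => hc ?_⟩
  · by_contra hne
    exact hc (coeff_eq_zero_of_mem_projAt hI y hne)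
  · rw [← pathCoord_evalAt hI hq hpre]
    exact (congrArg _ hy).trans (map_zero _)

theorem ker_projCover_le_radPow {y : ProjAt I q.src} (hy : projCover hI hq y = 0) :
    y ∈ radPow I (ProjAt I q.src) 1 := by
  have h : y.1 ∈ radPow I (BoundAlg I) 1 := by
    refine Submodule.span_induction (p := fun a _ => a ∈ radPow I (BoundAlg I) 1) ?_
      (AddSubgroup.zero_mem _) (fun _ _ _ _ => AddSubgroup.add_mem _)
      (fun c _ _ => smul_mem_radPow c) (mem_span_of_mem_ker hI hq hy)
    rintro _ ⟨u, ⟨-, hsrc, hpre⟩, rfl⟩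
    have hlen : 1 ≤ u.length := by
      by_contra h0
      refine hpre ?_
      rw [(eq_nil_of_length_eq_zero (show u.length = 0 by omega)).1, hsrc]
      exact isPrefix_nil q
    rw [← one_mul (pathClass I u)]
    exact pathAct_mem_radPow (I := I) hlen (1 : BoundAlg I)
  have := map_mem_radPow (evalAt (projGen I q.src)) h
  rwa [show evalAt (projGen I q.src) y.1 = y from op_smul_projGen y] at this

section Kernel

variable {f : Fin 2 → Option (QPath V)} {a : Fin 2 → QPath V}
  (ha : IsBranching comp? (IsNonzeroPath I) (nil q.src) q f a)
  (hf : ∀ i : Successor f, IsNonzeroPath I i.path)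

include ha in
theorem IsBranching.mul_eq_zero (i : Successor f) {w : QPath V} (hw : ¬ w.IsPrefix i.path) :
    pathClass I (a i.1) * pathClass I w = 0 := by
  cases h : comp? (a i.1) w with
  | none => exact pathClass_mul_of_none h
  | some v =>
    rw [pathClass_mul h]
    exact pathClass_eq_zero fun hv => hw (isPrefix_iff.mpr (ha.initial i.eq_some h hv))

include ha in
theorem IsBranching.exists_comp? (i : Successor f) {w : QPath V} (hw : w.IsPrefix i.path) :
    ∃ u, comp? (a i.1) w = some u ∧ IsNonzeroPath I u := by
  obtain ⟨v, hv, hN⟩ := ha.nonzero i.eq_some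
  obtain ⟨r, hr⟩ := isPrefix_iff.mp hw
  obtain ⟨u, hu, huv⟩ := isConcat_comp?.assoc_right hr hv
  exact ⟨u, hu, hN.left huv⟩

/-- Multiplication with `a i` on the left embeds the string module of the `i`-th successor of `q`
in `A`. -/
def branchMap (i : Successor f) : PathModule hI (hf i) →ₗ[k] BoundAlg I :=
  pathModuleLift hI (hf i) fun w => pathClass I (a i.1) * pathClass I w

include ha in
theorem branchMap_pathVec (i : Successor f) (w : QPath V) :
    branchMap hI (a := a) hf i (pathVec hI (hf i) w)
      = pathClass I (a i.1) * pathClass I w := by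
  by_cases hw : w.IsPrefix i.path
  · exact pathModuleLift_pathVec hI (hf i) _ hw
  · rw [pathVec_eq_zero hI (hf i) hw, map_zero, ha.mul_eq_zero i hw]

include ha in
theorem branchMap_pathAct (i : Successor f) (r : QPath V) (v : PathModule hI (hf i)) :
    branchMap hI (a := a) hf i (pathAct (I := I) r v)
      = pathAct (I := I) r (branchMap hI (a := a) hf i v) := by
  refine map_pathAct_of_pathVec hI (hf i) _ (fun r w _ => ?_) r v
  rw [branchMap_pathVec hI ha hf]
  change _ = pathClass I (a i.1) * pathClass I w * pathClass I r
  rw [mul_assoc]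
  cases h : comp? w r with
  | none =>
    rw [pathAct_pathVec_of_none hI (hf i) h, map_zero, pathClass_mul_of_none h, mul_zero]
  | some u => rw [pathAct_pathVec hI (hf i) h, branchMap_pathVec hI ha hf, pathClass_mul h]

/-- The embedding of the string module of the `i`-th successor of `q` in `P(x)`, where `x` is the
source of `q`. -/
def branchInclusion (i : Successor f) :
    PathModule hI (hf i) →ₗ[(BoundAlg I)ᵐᵒᵖ] ProjAt I q.src :=
  LinearMap.codRestrict _
    (linearMapOfPaths (branchMap hI (a := a) hf i) (branchMap_pathAct hI ha hf i)) fun v => by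
      have h : LinearMap.mulLeft k (pathClass I (nil q.src)) ∘ₗ branchMap hI (a := a) hf i
          = branchMap hI (a := a) hf i := by
        refine pathModule_hom_ext hI (hf i) fun w _ => ?_
        rw [LinearMap.comp_apply, branchMap_pathVec hI ha hf, LinearMap.mulLeft_apply,
          ← mul_assoc, pathClass_mul (ha.start i.eq_some)]
      exact mem_projAt.mpr (LinearMap.congr_fun h v)

theorem branchInclusion_pathVec (i : Successor f) (w : QPath V) :
    (branchInclusion hI ha hf i (pathVec hI (hf i) w)).1
      = pathClass I (a i.1) * pathClass I w :=
  branchMap_pathVec hI ha hf i w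

/-- The sum of the embeddings of the string modules of the successors of `q`. -/
def kernelInclusion :
    (⨁ i : Successor f, PathModule hI (hf i)) →ₗ[(BoundAlg I)ᵐᵒᵖ] ProjAt I q.src :=
  DirectSum.toModule _ _ _ (branchInclusion hI ha hf)

/-- The coordinates of an element of the direct sum of the string modules of the successors are
coefficients of its image in `P(x)`. -/
theorem coeff_kernelInclusion (j : Successor f) {w u : QPath V} (hw : w.IsPrefix j.path)
    (hu : comp? (a j.1) w = some u) (z : ⨁ i : Successor f, PathModule hI (hf i)) :
    coeff hI u (kernelInclusion hI ha hf z).1 = pathCoord hI (hf j) w (z j) := by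
  have huN : IsNonzeroPath I u := by
    obtain ⟨u', hu', hN⟩ := ha.exists_comp? j hw
    rwa [Option.some.inj (hu.symm.trans hu')]
  induction z using DirectSum.induction_on with
  | zero => rw [map_zero, DirectSum.zero_apply, map_zero]; exact map_zero _
  | add z z' hz hz' =>
    rw [map_add, DirectSum.add_apply, map_add, ← hz, ← hz']
    exact map_add _ _ _
  | of i v =>
    have hof : kernelInclusion hI ha hf (DirectSum.of _ i v) = branchInclusion hI ha hf i v :=
      DirectSum.toModule_lof _ _ _
    rw [hof]
    change (coeff hI u ∘ₗ branchMap hI (a := a) hf i) v = _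
    by_cases hij : i = j
    · subst hij
      rw [DirectSum.of_eq_same]
      refine LinearMap.congr_fun (pathModule_hom_ext hI (hf i) fun w' hw' => ?_) v
      rw [LinearMap.comp_apply, branchMap_pathVec hI ha hf]
      obtain ⟨u', hu', -⟩ := ha.exists_comp? i hw'
      rw [pathClass_mul hu']
      by_cases hww : w' = w
      · subst hww
        rw [pathCoord_self hI (hf i) hw', Option.some.inj (hu'.symm.trans hu), coeff_self hI huN]
      · rw [pathCoord_of_ne hI (hf i) hww, coeff_of_ne hI]
        rintro rfl
        exact hww (isConcat_comp?.inj hu' hu rfl).2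
    · rw [DirectSum.of_eq_of_ne _ _ _ (Ne.symm hij), map_zero]
      refine LinearMap.congr_fun (g := 0) (pathModule_hom_ext hI (hf i) fun w' hw' => ?_) v
      rw [LinearMap.comp_apply, branchMap_pathVec hI ha hf, LinearMap.zero_apply]
      obtain ⟨u', hu', -⟩ := ha.exists_comp? i hw'
      rw [pathClass_mul hu', coeff_of_ne hI]
      rintro rfl
      exact hij (Subtype.ext (ha.disjoint i.eq_some j.eq_some huN ⟨w', hu'⟩ ⟨w, hu⟩))

theorem kernelInclusion_injective : Function.Injective (kernelInclusion hI ha hf) := by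
  rw [injective_iff_map_eq_zero]
  intro z hz
  refine DFinsupp.ext fun j => eq_zero_of_pathCoord hI (hf j) fun w hw => ?_
  obtain ⟨u, hu, -⟩ := ha.exists_comp? j hw
  rw [← coeff_kernelInclusion hI ha hf j hw hu, hz]
  exact map_zero _

/-- The first syzygy of `M(q)` is the direct sum of the string modules of the successors of `q`. -/
theorem range_kernelInclusion :
    LinearMap.range (kernelInclusion hI ha hf) = LinearMap.ker (projCover hI hq) := by
  apply le_antisymm
  · rw [LinearMap.range_le_ker_iff]
    refine DirectSum.linearMap_ext _ fun i => LinearMap.ext fun v => ?_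
    have h : (projCover hI hq ∘ₗ branchInclusion hI ha hf i).restrictScalars k = 0 := by
      refine pathModule_hom_ext hI (hf i) fun w hw => ?_
      change evalAt (pathVec hI hq (nil q.src))
        (branchInclusion hI ha hf i (pathVec hI (hf i) w)).1 = 0
      obtain ⟨u, hu, -⟩ := ha.exists_comp? i hw
      have hsrc : u.src = q.src :=
        (comp?_src hu).trans (nil_comp?_iff.mp (ha.start i.eq_some)).1
      rw [branchInclusion_pathVec, pathClass_mul hu, evalAt_pathVec hI hq u hsrc]
      refine pathVec_eq_zero hI hq fun hpre => ha.not_initial i.eq_some ?_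
      exact isConcat_comp?.initial_trans ⟨w, hu⟩ (isPrefix_iff.mp hpre)
    have h2 : kernelInclusion hI ha hf (DirectSum.lof _ _ _ i v) = branchInclusion hI ha hf i v :=
      DirectSum.toModule_lof _ _ _
    change projCover hI hq (kernelInclusion hI ha hf (DirectSum.lof _ _ _ i v)) = 0
    rw [h2]
    exact LinearMap.congr_fun h v
  · intro y hy
    have hle : Submodule.span k
        (pathClass I '' {u | IsNonzeroPath I u ∧ u.src = q.src ∧ ¬ u.IsPrefix q}) ≤
        (LinearMap.range (Submodule.subtype _ ∘ₗ kernelInclusion hI ha hf)).restrictScalars k := by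
      rw [Submodule.span_le]
      rintro _ ⟨u, ⟨hu, hsrc, hpre⟩, rfl⟩
      obtain ⟨i, q', hi, r, hr⟩ := ha.exists_initial hu (nil_comp?_iff.mpr ⟨hsrc, rfl⟩)
        fun h => hpre (isPrefix_iff.mpr h)
      let j : Successor f := ⟨i, by rw [hi]; rfl⟩
      refine ⟨DirectSum.lof (BoundAlg I)ᵐᵒᵖ _ _ j (pathVec hI (hf j) r), ?_⟩
      have h2 : kernelInclusion hI ha hf (DirectSum.lof _ _ _ j (pathVec hI (hf j) r))
          = branchInclusion hI ha hf j (pathVec hI (hf j) r) := DirectSum.toModule_lof _ _ _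
      rw [LinearMap.comp_apply, h2, Submodule.subtype_apply, branchInclusion_pathVec]
      exact pathClass_mul hr
    obtain ⟨z, hz⟩ := hle (mem_span_of_mem_ker hI hq hy)
    exact ⟨z, Subtype.ext hz⟩

end Kernel

end ProjectiveCover

/-! ### The injective envelope of a string module and its cokernel -/

section InjectiveEnvelope

open QPath

variable {k V : Type u} [Field k] [Quiver.{u} V] [Fintype V] {I : TwoSidedIdeal (PathAlgebra k V)}

instance (x : V) : Module k (InjAt I x) := inferInstanceAs (Module k (LeftProjAt I x →ₗ[k] k))

theorem mem_leftProjAt {x : V} {y : BoundAlg I} :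
    y ∈ (Submodule.span (BoundAlg I) {idem I x} : Submodule (BoundAlg I) (BoundAlg I)) ↔
      y * pathClass I (nil x) = y := by
  rw [Submodule.mem_span_singleton]
  constructor
  · rintro ⟨a, rfl⟩
    change a * pathClass I (nil x) * pathClass I (nil x) = a * pathClass I (nil x)
    rw [mul_assoc, pathClass_nil_mul_nil]
  · intro h
    exact ⟨y, h⟩

theorem mul_pathClass_nil_mem {x : V} (a : BoundAlg I) : a * pathClass I (nil x) ∈
    (Submodule.span (BoundAlg I) {idem I x} : Submodule (BoundAlg I) (BoundAlg I)) :=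
  Submodule.mem_span_singleton.mpr ⟨a, rfl⟩

/-- An element of `I(x) = D(A e_x)`, extended to a functional on `A` by means of the projection
`a ↦ a e_x`. -/
def injEval {x : V} (φ : InjAt I x) : BoundAlg I →ₗ[k] k where
  toFun a := (show LeftProjAt I x →ₗ[k] k from φ) ⟨a * pathClass I (nil x), mul_pathClass_nil_mem a⟩
  map_add' a b := by
    rw [← map_add]
    exact congrArg _ (Subtype.ext (add_mul a b _))
  map_smul' c a := by
    rw [RingHom.id_apply, ← map_smul]
    exact congrArg _ (Subtype.ext (smul_mul_assoc c a _))

theorem injEval_coe {x : V} (φ : InjAt I x) (b : LeftProjAt I x) :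
    injEval φ b.1 = (show LeftProjAt I x →ₗ[k] k from φ) b :=
  congrArg (show LeftProjAt I x →ₗ[k] k from φ) (Subtype.ext (mem_leftProjAt.mp b.2))

theorem injEval_injective {x : V} {φ ψ : InjAt I x} (h : injEval φ = injEval ψ) : φ = ψ :=
  LinearMap.ext fun b => by
    rw [← injEval_coe φ, ← injEval_coe ψ, h]

theorem injEval_smul {x : V} (c : k) (φ : InjAt I x) (a : BoundAlg I) :
    injEval (c • φ) a = c * injEval φ a := rfl

theorem injEval_op_smul {x : V} (a : (BoundAlg I)ᵐᵒᵖ) (φ : InjAt I x) (b : BoundAlg I) :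
    injEval (a • φ) b = injEval φ (a.unop * b) :=
  congrArg (show LeftProjAt I x →ₗ[k] k from φ) (Subtype.ext (mul_assoc _ _ _).symm)

theorem injEval_pathClass_of_ne {x : V} (φ : InjAt I x) {u : QPath V} (hu : u.tgt ≠ x) :
    injEval φ (pathClass I u) = 0 := by
  have h : (⟨pathClass I u * pathClass I (nil x), mul_pathClass_nil_mem _⟩ : LeftProjAt I x) = 0 :=
    Subtype.ext (pathClass_mul_of_none (comp?_of_ne hu))
  exact (congrArg (show LeftProjAt I x →ₗ[k] k from φ) h).trans (map_zero _)

theorem injAt_ext {x : V} {φ ψ : InjAt I x} (h : ∀ u : QPath V, IsNonzeroPath I u → u.tgt = x →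
    injEval φ (pathClass I u) = injEval ψ (pathClass I u)) : φ = ψ := by
  refine injEval_injective (boundAlg_hom_ext fun u => ?_)
  by_cases hx : u.tgt = x
  · by_cases hu : IsNonzeroPath I u
    · exact h u hu hx
    · rw [pathClass_eq_zero hu, map_zero, map_zero]
  · rw [injEval_pathClass_of_ne φ hx, injEval_pathClass_of_ne ψ hx]

instance (x : V) : IsScalarTower k (BoundAlg I)ᵐᵒᵖ (InjAt I x) where
  smul_assoc c a φ := injEval_injective <| LinearMap.ext fun b => by
    rw [injEval_smul, injEval_op_smul, injEval_op_smul, MulOpposite.unop_smul, smul_mul_assoc,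
      map_smul, smul_eq_mul]

/-- Restriction of a functional on `A` to `A e_x`. -/
def injMk {x : V} (g : BoundAlg I →ₗ[k] k) : InjAt I x :=
  g ∘ₗ (Submodule.subtype _).restrictScalars k

theorem injEval_injMk {x : V} (g : BoundAlg I →ₗ[k] k) {u : QPath V} (hu : u.tgt = x) :
    injEval (injMk g : InjAt I x) (pathClass I u) = g (pathClass I u) := by
  change g (pathClass I u * pathClass I (nil x)) = _
  rw [pathClass_mul (comp?_nil_iff.mpr ⟨hu, rfl⟩)]

section Coinduction

variable {X : Type u} [AddCommGroup X] [Module (BoundAlg I)ᵐᵒᵖ X] [Module k X]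
  [IsScalarTower k (BoundAlg I)ᵐᵒᵖ X]

/-- The `A`-linear map `X → I(x)` corresponding to a functional on `X`, or rather to its restriction
to `X e_x`: it sends `y` to the functional `b ↦ ε (y b)`. -/
def coind (x : V) (ε : X →ₗ[k] k) : X →ₗ[(BoundAlg I)ᵐᵒᵖ] InjAt I x where
  toFun y := injMk (ε ∘ₗ (evalAt y).restrictScalars k)
  map_add' y z := LinearMap.ext fun b =>
    (congrArg ε (smul_add (MulOpposite.op b.1) y z)).trans (map_add ε _ _)
  map_smul' a y := LinearMap.ext fun b =>
    congrArg ε (mul_smul (MulOpposite.op b.1) a y).symm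

theorem injEval_coind {x : V} (ε : X →ₗ[k] k) (y : X) {u : QPath V} (hu : u.tgt = x) :
    injEval (coind x ε y) (pathClass I u) = ε (pathAct (I := I) u y) :=
  injEval_injMk _ hu

end Coinduction

/-- `I(x)` is injective: an `A`-linear map to `I(x)` is determined by the functional
`y ↦ h y e_x`, and functionals extend because `k` is a field. -/
instance injective_injAt (x : V) : Module.Injective (BoundAlg I)ᵐᵒᵖ (InjAt I x) := by
  refine ⟨fun X Y _ _ _ _ g hg h => ?_⟩
  let _ : Module k X := Module.compHom X (algebraMap k (BoundAlg I)ᵐᵒᵖ)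
  let _ : Module k Y := Module.compHom Y (algebraMap k (BoundAlg I)ᵐᵒᵖ)
  have : IsScalarTower k (BoundAlg I)ᵐᵒᵖ X := ⟨fun c a y => by
    rw [Algebra.smul_def, mul_smul]; rfl⟩
  have : IsScalarTower k (BoundAlg I)ᵐᵒᵖ Y := ⟨fun c a y => by
    rw [Algebra.smul_def, mul_smul]; rfl⟩
  obtain ⟨l, hl⟩ := LinearMap.exists_leftInverse_of_injective (g.restrictScalars k)
    (LinearMap.ker_eq_bot.mpr hg)
  -- the functional on `X` that corresponds to `h`
  let ε : X →ₗ[k] k :=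
    { toFun := fun y => injEval (h y) 1
      map_add' := fun y z => by rw [map_add]; rfl
      map_smul' := fun c y => by
        rw [← LinearMap.restrictScalars_apply k h, map_smul]; rfl }
  refine ⟨coind x (ε ∘ₗ l), fun y => injAt_ext fun u _ hu => ?_⟩
  rw [injEval_coind _ _ hu, pathAct, ← map_smul]
  have h1 : ∀ z, l (g z) = z := fun z => LinearMap.congr_fun hl z
  rw [LinearMap.comp_apply, h1]
  change injEval (h _) 1 = _
  rw [map_smul, injEval_op_smul, mul_one, MulOpposite.unop_op]

section Coordinates

variable (hI : IsMonomial I) {p : QPath V} (hp : IsNonzeroPath I p)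

theorem pathModule_ext {v v' : PathModule hI hp} (h : ∀ w z : QPath V, comp? w z = some p →
    pathCoord hI hp w v = pathCoord hI hp w v') : v = v' := by
  rw [← sub_eq_zero]
  refine eq_zero_of_pathCoord hI hp fun w hw => ?_
  obtain ⟨z, hz⟩ := isPrefix_iff.mp hw
  rw [map_sub, h w z hz, sub_self]

/-- The linear map `I(x) → M(p)` for which the coordinate of the image of `φ` at an initial subpath
`w` of `p = w z` is the value of `φ` at `z a`. -/
def coordMap (x : V) (a : QPath V) : InjAt I x →ₗ[k] PathModule hI hp :=
  (Finsupp.linearEquivFunOnFinite k k {w : QPath V // w.IsPrefix p}).symm.toLinearMap ∘ₗ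
    LinearMap.pi fun w =>
      { toFun := fun φ => injEval φ (pathClass I (isPrefix_iff.mp w.2).choose * pathClass I a)
        map_add' := fun _ _ => rfl
        map_smul' := fun _ _ => rfl }

theorem pathCoord_coordMap {x : V} (a : QPath V) (φ : InjAt I x) {w z : QPath V}
    (h : comp? w z = some p) :
    pathCoord hI hp w (coordMap hI hp x a φ) = injEval φ (pathClass I z * pathClass I a) := by
  have hw : w.IsPrefix p := isPrefix_iff.mpr ⟨z, h⟩
  have hz : (isPrefix_iff.mp hw).choose = z :=
    (isConcat_comp?.inj (isPrefix_iff.mp hw).choose_spec h rfl).2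
  have hc : pathCoord hI hp w = Finsupp.lapply (⟨w, hw⟩ : {w : QPath V // w.IsPrefix p}) := by
    refine pathModule_hom_ext hI hp fun w' hw' => ?_
    change _ = (PathSpace.vec k p (some w')) _
    rw [PathSpace.vec, dif_pos hw']
    by_cases hww : w' = w
    · subst hww
      rw [pathCoord_self hI hp hw', Finsupp.single_eq_same]
    · rw [pathCoord_of_ne hI hp hww,
        Finsupp.single_eq_of_ne' fun h => hww (congrArg Subtype.val h)]
  rw [hc, ← hz]
  rfl

/-- Acting with `r` shifts coordinates: the coordinate of `v r` at `w r` is that of `v` at `w`. -/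
theorem pathCoord_pathAct {w r w' : QPath V} (h : comp? w r = some w') (hw' : w'.IsPrefix p)
    (v : PathModule hI hp) :
    pathCoord hI hp w' (pathAct (I := I) r v) = pathCoord hI hp w v := by
  refine LinearMap.congr_fun (f := pathCoord hI hp w' ∘ₗ
    Algebra.lsmul k k (PathModule hI hp) (MulOpposite.op (pathClass I r)))
    (pathModule_hom_ext hI hp fun u _ => ?_) v
  change pathCoord hI hp w' (pathAct (I := I) r (pathVec hI hp u)) = _
  by_cases huw : u = w
  · subst huw
    have hu : u.IsPrefix p :=
      isPrefix_iff.mpr (isConcat_comp?.initial_trans ⟨r, h⟩ (isPrefix_iff.mp hw'))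
    rw [pathAct_pathVec hI hp h, pathCoord_self hI hp hw', pathCoord_self hI hp hu]
  · rw [pathCoord_of_ne hI hp huw]
    cases hur : comp? u r with
    | none => rw [pathAct_pathVec_of_none hI hp hur, map_zero]
    | some y =>
      rw [pathAct_pathVec hI hp hur, pathCoord_of_ne hI hp]
      rintro rfl
      exact huw (isConcat_comp?.flip.inj hur h rfl).2

theorem pathCoord_pathAct_eq_zero {r w' : QPath V} (h : ∀ w, comp? w r ≠ some w')
    (v : PathModule hI hp) : pathCoord hI hp w' (pathAct (I := I) r v) = 0 := by
  refine LinearMap.congr_fun (g := 0) (f := pathCoord hI hp w' ∘ₗ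
    Algebra.lsmul k k (PathModule hI hp) (MulOpposite.op (pathClass I r)))
    (pathModule_hom_ext hI hp fun u _ => ?_) v
  change pathCoord hI hp w' (pathAct (I := I) r (pathVec hI hp u)) = 0
  cases hur : comp? u r with
  | none => rw [pathAct_pathVec_of_none hI hp hur, map_zero]
  | some y =>
    rw [pathAct_pathVec hI hp hur, pathCoord_of_ne hI hp]
    rintro rfl
    exact h u hur

end Coordinates

variable (hI : IsMonomial I) {q : QPath V} (hq : IsNonzeroPath I q)

/-- The injective envelope `M(q) → I(x)` of the string module of a path `q` ending at `x`. -/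
def injEnvelope : PathModule hI hq →ₗ[(BoundAlg I)ᵐᵒᵖ] InjAt I q.tgt :=
  coind q.tgt (pathCoord hI hq q)

theorem injEval_injEnvelope {w z : QPath V} (h : comp? w z = some q) (v : PathModule hI hq) :
    injEval (injEnvelope hI hq v) (pathClass I z) = pathCoord hI hq w v := by
  rw [injEnvelope, injEval_coind _ _ (comp?_tgt h).symm,
    pathCoord_pathAct hI hq h (isPrefix_refl q)]

theorem injEval_injEnvelope_eq_zero {z : QPath V} (h : ¬ Initial (flip comp?) z q)
    (v : PathModule hI hq) : injEval (injEnvelope hI hq v) (pathClass I z) = 0 := by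
  by_cases hz : z.tgt = q.tgt
  · rw [injEnvelope, injEval_coind _ _ hz]
    exact pathCoord_pathAct_eq_zero hI hq (fun w hw => h ⟨w, hw⟩) v
  · exact injEval_pathClass_of_ne _ hz

theorem injEnvelope_injective : Function.Injective (injEnvelope hI hq) := fun v v' h =>
  pathModule_ext hI hq fun w z hwz => by
    rw [← injEval_injEnvelope hI hq hwz, ← injEval_injEnvelope hI hq hwz, h]

/-- An element of `I(x)` that vanishes at all non-zero paths that are not terminal subpaths of `q`
lies in the image of `M(q)`. -/
theorem mem_range_injEnvelope {φ : InjAt I q.tgt}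
    (h : ∀ u, IsNonzeroPath I u → u.tgt = q.tgt → ¬ Initial (flip comp?) u q →
      injEval φ (pathClass I u) = 0) : φ ∈ LinearMap.range (injEnvelope hI hq) := by
  refine ⟨coordMap hI hq q.tgt (nil q.tgt) φ, injAt_ext fun u hu htgt => ?_⟩
  by_cases huq : Initial (flip comp?) u q
  · obtain ⟨w, hw⟩ := huq
    replace hw : comp? w u = some q := hw
    rw [injEval_injEnvelope hI hq hw, pathCoord_coordMap hI hq _ _ hw,
      pathClass_mul (comp?_nil_iff.mpr ⟨htgt, rfl⟩)]
  · rw [h u hu htgt huq, injEval_injEnvelope_eq_zero hI hq huq]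

/-- The image of `M(q)` contains the socle of `I(x)`. -/
theorem mem_range_injEnvelope_of_socle {φ : InjAt I q.tgt}
    (h : ∀ α : QPath V, α.length = 1 → pathAct (I := I) α φ = 0) :
    φ ∈ LinearMap.range (injEnvelope hI hq) := by
  refine mem_range_injEnvelope hI hq fun u hu htgt huq => ?_
  have hlen : 1 ≤ u.length := by
    by_contra h0
    rw [(eq_nil_of_length_eq_zero (show u.length = 0 by omega)).2, htgt] at huq
    exact huq ⟨q, comp?_nil q⟩
  obtain ⟨α, r, hr, hα⟩ := isConcat_comp?.split hlen
  have h1 := injEval_op_smul (MulOpposite.op (pathClass I α)) φ (pathClass I r)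
  rw [MulOpposite.unop_op, pathClass_mul hr] at h1
  rw [← h1]
  change injEval (pathAct (I := I) α φ) _ = 0
  rw [h α hα]
  rfl

section Cokernel

variable {f : Fin 2 → Option (QPath V)} {a : Fin 2 → QPath V}
  (ha : IsBranching (flip comp?) (IsNonzeroPath I) (nil q.tgt) q f a)
  (hf : ∀ i : Successor f, IsNonzeroPath I i.path)

include ha in
theorem IsBranching.exists_comp?_flip (i : Successor f) {w z : QPath V}
    (h : comp? w z = some i.path) :
    ∃ u, comp? z (a i.1) = some u ∧ IsNonzeroPath I u ∧ u.tgt = q.tgt := by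
  obtain ⟨v, hv, hN⟩ := ha.nonzero i.eq_some
  obtain ⟨u, hu, huv⟩ := isConcat_comp?.assoc_left h hv
  refine ⟨u, hu, hN.right huv, (comp?_tgt hu).trans ?_⟩
  exact (comp?_nil_iff.mp (ha.start i.eq_some)).1

include ha in
/-- The coordinates of the image of `φ` are compatible with the action because a non-zero path that
ends in `a i` is `y (a i)` for a terminal subpath `y` of the successor. -/
theorem coordMap_pathAct (i : Successor f) (r : QPath V) (φ : InjAt I q.tgt) :
    coordMap hI (hf i) q.tgt (a i.1) (pathAct (I := I) r φ)
      = pathAct (I := I) r (coordMap hI (hf i) q.tgt (a i.1) φ) := by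
  refine pathModule_ext hI (hf i) fun w' z' hz' => ?_
  rw [pathCoord_coordMap hI (hf i) _ _ hz']
  refine (injEval_op_smul _ φ _).trans ?_
  rw [MulOpposite.unop_op, ← mul_assoc]
  by_cases hex : ∃ w, comp? w r = some w'
  · obtain ⟨w, hw⟩ := hex
    obtain ⟨z, hz, hwz⟩ := isConcat_comp?.assoc_left hw hz'
    rw [pathCoord_pathAct hI (hf i) hw (isPrefix_iff.mpr ⟨z', hz'⟩),
      pathCoord_coordMap hI (hf i) _ _ hwz, pathClass_mul hz]
  · rw [pathCoord_pathAct_eq_zero hI (hf i) fun w hw => hex ⟨w, hw⟩]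
    -- `r z' a` is zero, because otherwise `r z'` would be a terminal subpath of the successor
    have h0 : pathClass I r * pathClass I z' * pathClass I (a i.1) = 0 := by
      cases hy : comp? r z' with
      | none => rw [pathClass_mul_of_none hy, zero_mul]
      | some y =>
        rw [pathClass_mul hy]
        cases hv : comp? y (a i.1) with
        | none => exact pathClass_mul_of_none hv
        | some v =>
          rw [pathClass_mul hv]
          refine pathClass_eq_zero fun hN => hex ?_
          obtain ⟨w, hw⟩ := ha.initial i.eq_some hv hN
          obtain ⟨w'', hw'', h2⟩ := isConcat_comp?.assoc_right hy hw
          obtain ⟨-, rfl⟩ := isConcat_comp?.flip.inj h2 hz' rfl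
          exact ⟨w, hw''⟩
    rw [h0, map_zero]

/-- The projection of `I(x)`, where `x` is the target of `q`, to the string modules of the
successors of `q`. -/
def cokernelProjection :
    InjAt I q.tgt →ₗ[(BoundAlg I)ᵐᵒᵖ] ⨁ i : Successor f, PathModule hI (hf i) :=
  (DirectSum.linearEquivFunOnFintype (BoundAlg I)ᵐᵒᵖ (Successor f)
      fun i => PathModule hI (hf i)).symm.toLinearMap ∘ₗ
    LinearMap.pi fun i => linearMapOfPaths (coordMap hI (hf i) q.tgt (a i.1))
      (coordMap_pathAct hI ha hf i)

theorem cokernelProjection_apply (φ : InjAt I q.tgt) (i : Successor f) :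
    cokernelProjection hI ha hf φ i = coordMap hI (hf i) q.tgt (a i.1) φ := by
  have h := LinearEquiv.apply_symm_apply (DirectSum.linearEquivFunOnFintype
    (BoundAlg I)ᵐᵒᵖ (Successor f) fun i => PathModule hI (hf i))
    fun i => coordMap hI (hf i) q.tgt (a i.1) φ
  exact congrFun h i

theorem cokernelProjection_surjective : Function.Surjective (cokernelProjection hI ha hf) := by
  intro y
  induction y using DirectSum.induction_on with
  | zero => exact ⟨0, map_zero _⟩
  | add y y' hy hy' =>
    obtain ⟨φ, rfl⟩ := hy
    obtain ⟨ψ, rfl⟩ := hy'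
    exact ⟨φ + ψ, map_add _ _ _⟩
  | of i v =>
    refine Submodule.span_induction (p := fun v _ => ∃ φ, cokernelProjection hI ha hf φ
      = DirectSum.lof (BoundAlg I)ᵐᵒᵖ _ (fun i => PathModule hI (hf i)) i v) ?_
      ⟨0, by rw [map_zero, map_zero]⟩ ?_ ?_ (mem_span_pathVec hI (hf i) v)
    · rintro _ ⟨w, ⟨hw, -⟩, rfl⟩
      obtain ⟨z, hz⟩ := isPrefix_iff.mp hw
      obtain ⟨u, hu, hN, htgt⟩ := ha.exists_comp?_flip i hz
      refine ⟨injMk (coeff hI u), DFinsupp.ext fun j => ?_⟩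
      refine (cokernelProjection_apply hI ha hf _ j).trans ?_
      refine pathModule_ext hI (hf j) fun w' z' hz' => ?_
      obtain ⟨u', hu', -, htgt'⟩ := ha.exists_comp?_flip j hz'
      rw [pathCoord_coordMap hI (hf j) _ _ hz', pathClass_mul hu', injEval_injMk _ htgt']
      by_cases hij : i = j
      · subst hij
        rw [show (DirectSum.lof (BoundAlg I)ᵐᵒᵖ _ (fun i => PathModule hI (hf i)) i
          (pathVec hI (hf i) w)) i = pathVec hI (hf i) w from DirectSum.lof_apply _ _ _]
        by_cases hww : w = w'
        · subst hww
          obtain ⟨-, rfl⟩ := isConcat_comp?.inj hz hz' rfl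
          rw [← Option.some.inj (hu.symm.trans hu'), coeff_self hI hN,
            pathCoord_self hI (hf i) hw]
        · rw [pathCoord_of_ne hI (hf i) hww, coeff_of_ne hI]
          rintro rfl
          obtain ⟨-, rfl⟩ := isConcat_comp?.flip.inj hu hu' rfl
          exact hww (isConcat_comp?.flip.inj hz hz' rfl).2
      · rw [show (DirectSum.lof (BoundAlg I)ᵐᵒᵖ _ (fun i => PathModule hI (hf i)) i
          (pathVec hI (hf i) w)) j = 0 from DirectSum.of_eq_of_ne _ _ _ (Ne.symm hij),
          map_zero, coeff_of_ne hI]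
        rintro rfl
        exact hij (Subtype.ext (ha.disjoint i.eq_some j.eq_some hN ⟨z, hu⟩ ⟨z', hu'⟩))
    · rintro v v' - - ⟨φ, hφ⟩ ⟨ψ, hψ⟩
      exact ⟨φ + ψ, by rw [map_add, map_add, hφ, hψ]⟩
    · rintro c v - ⟨φ, hφ⟩
      refine ⟨algebraMap k (BoundAlg I)ᵐᵒᵖ c • φ, ?_⟩
      rw [map_smul, hφ, ← map_smul, algebraMap_smul]

/-- The first cosyzygy of `M(q)` is the direct sum of the string modules of the successors of `q`. -/
theorem range_injEnvelope_eq_ker :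
    LinearMap.range (injEnvelope hI hq) = LinearMap.ker (cokernelProjection hI ha hf) := by
  apply le_antisymm
  · rintro _ ⟨v, rfl⟩
    refine DFinsupp.ext fun i => (cokernelProjection_apply hI ha hf _ i).trans ?_
    refine pathModule_ext hI (hf i) fun w z hz => ?_
    obtain ⟨u, hu, -⟩ := ha.exists_comp?_flip i hz
    rw [pathCoord_coordMap hI (hf i) _ _ hz, pathClass_mul hu,
      injEval_injEnvelope_eq_zero hI hq, DFinsupp.zero_apply, map_zero]
    exact fun huq => ha.not_initial i.eq_some (isConcat_comp?.flip.initial_trans ⟨z, hu⟩ huq)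
  · intro φ hφ
    refine mem_range_injEnvelope hI hq fun u hu htgt huq => ?_
    obtain ⟨i, q', hi, z, hz⟩ := ha.exists_initial hu (comp?_nil_iff.mpr ⟨htgt, rfl⟩) huq
    replace hz : comp? z (a i) = some u := hz
    let j : Successor f := ⟨i, by rw [hi]; rfl⟩
    obtain ⟨w, hw⟩ := ha.initial j.eq_some hz hu
    replace hw : comp? w z = some j.path := hw
    rw [← pathClass_mul hz, ← pathCoord_coordMap hI (hf j) (a i) φ hw,
      ← cokernelProjection_apply hI ha hf φ j, LinearMap.mem_ker.mp hφ, DFinsupp.zero_apply,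
      map_zero]

end Cokernel

end InjectiveEnvelope

/-! ### Direct sums over the tuples of a maximal sequence -/

section Tuples

variable {V : Type u} [Quiver.{u} V] {s : List (Fin 2) → Option (QPath V)}

theorem ExistingTuples.eq_some {l : ℕ} (t : ExistingTuples s l) : s t.1 = some t.path :=
  (Option.some_get t.2.2).symm

instance finite_existingTuples (l : ℕ) : Finite (ExistingTuples s l) := by
  have h : {t : List (Fin 2) | t.length + 1 = l ∧ (s t).isSome}.Finite :=
    (List.finite_length_eq (Fin 2) (l - 1)).subset fun t ht => by
      have := ht.1
      change t.length = l - 1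
      omega
  exact h.to_subtype

/-- The tuple obtained from `t` by appending the index of a successor. -/
def ExistingTuples.append {l : ℕ}
    (σ : Σ t : ExistingTuples s l, Successor fun i => s (t.1 ++ [i])) :
    ExistingTuples s (l + 1) :=
  ⟨σ.1.1 ++ [σ.2.1], by rw [List.length_append, List.length_singleton, σ.1.2.1], σ.2.2⟩

theorem ExistingTuples.append_bijective
    (hnone : ∀ t, s t = none → ∀ i : Fin 2, s (t ++ [i]) = none) {l : ℕ} (hl : 1 ≤ l) :
    Function.Bijective (ExistingTuples.append (s := s) (l := l)) := by
  constructor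
  · rintro ⟨⟨t, ht⟩, i, hi⟩ ⟨⟨t', ht'⟩, i', hi'⟩ h
    obtain ⟨h1, h2⟩ := List.append_inj' (congrArg Subtype.val h) rfl
    obtain rfl : t = t' := h1
    obtain rfl : i = i' := by simpa using h2
    rfl
  · rintro ⟨t, ht, hsome⟩
    have hne : t ≠ [] := by
      rintro rfl
      simp only [List.length_nil] at ht
      omega
    have happ := List.dropLast_append_getLast hne
    -- a tuple that exists has an existing parent, because non-existence is inherited
    have hsome' : (s t.dropLast).isSome := by
      rw [Option.isSome_iff_ne_none]
      intro h0
      have h1 := hnone _ h0 (t.getLast hne)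
      rw [happ] at h1
      rw [h1] at hsome
      cases hsome
    have hlen : t.dropLast.length + 1 = l := by
      rw [List.length_dropLast]
      omega
    exact ⟨⟨⟨t.dropLast, hlen, hsome'⟩, t.getLast hne,
      (congrArg (fun t => (s t).isSome = true) happ).mpr hsome⟩, Subtype.ext happ⟩

/-- The tuples of length `l + 1` are those obtained from the tuples of length `l` by appending the
index of a successor. -/
def ExistingTuples.equiv (hnone : ∀ t, s t = none → ∀ i : Fin 2, s (t ++ [i]) = none)
    {l : ℕ} (hl : 1 ≤ l) : ExistingTuples s (l + 1) ≃
      Σ t : ExistingTuples s l, Successor fun i => s (t.1 ++ [i]) :=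
  (Equiv.ofBijective _ (ExistingTuples.append_bijective hnone hl)).symm

end Tuples

section Resolutions

open QPath

variable {k V : Type u} [Field k] [Quiver.{u} V] [Fintype V] {I : TwoSidedIdeal (PathAlgebra k V)}
  (hI : IsMonomial I) {s : List (Fin 2) → Option (QPath V)}
  (hN : ∀ t q, s t = some q → IsNonzeroPath I q)

/-- The direct sum of the string modules of the paths in a maximal sequence that belong to the
tuples of length `l`. -/
abbrev StringSum (l : ℕ) : Type u :=
  ⨁ t : ExistingTuples s l, PathModule hI (hN t.1 t.path t.eq_some)

/-- The sum of the string modules of tuples of length `l + 1`, grouped by the tuples of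
length `l`. -/
def stringSumEquiv (hnone : ∀ t, s t = none → ∀ i : Fin 2, s (t ++ [i]) = none)
    {l : ℕ} (hl : 1 ≤ l) :
    StringSum hI hN (l + 1) ≃ₗ[(BoundAlg I)ᵐᵒᵖ]
      ⨁ t : ExistingTuples s l, ⨁ i : Successor (fun i => s (t.1 ++ [i])),
        PathModule hI (hN _ i.path i.eq_some) :=
  (DirectSum.lequivCongrLeft (BoundAlg I)ᵐᵒᵖ (ExistingTuples.equiv hnone hl)).trans
    (DirectSum.sigmaLcurryEquiv (BoundAlg I)ᵐᵒᵖ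
      (δ := fun (t : ExistingTuples s l) (i : Successor fun i => s (t.1 ++ [i])) =>
        PathModule hI (hN _ i.path i.eq_some)))

/-- In degree zero the sum consists of the string module of the path the sequence begins with. -/
theorem nonempty_stringSum_one_equiv {p : QPath V} (hp : IsNonzeroPath I p) (hs : s [] = some p) :
    Nonempty (PathModule hI hp ≃ₗ[(BoundAlg I)ᵐᵒᵖ] StringSum hI hN 1) := by
  let t₀ : ExistingTuples s 1 := ⟨[], rfl, by rw [hs]; rfl⟩
  have huniq : ∀ t : ExistingTuples s 1, t = t₀ := fun t =>
    Subtype.ext (List.eq_nil_of_length_eq_zero (Nat.succ.inj t.2.1))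
  have hp₀ : t₀.path = p := Option.some.inj (t₀.eq_some.symm.trans hs)
  have hcongr : ∀ (p' : QPath V) (hp' : IsNonzeroPath I p'), p' = p →
      Nonempty (PathModule hI hp ≃ₗ[(BoundAlg I)ᵐᵒᵖ] PathModule hI hp') := by
    rintro p' hp' rfl
    exact ⟨LinearEquiv.refl _ _⟩
  obtain ⟨e⟩ := hcongr t₀.path (hN _ _ t₀.eq_some) hp₀
  let g : StringSum hI hN 1 →ₗ[(BoundAlg I)ᵐᵒᵖ] PathModule hI (hN _ _ t₀.eq_some) :=
    DirectSum.component _ _ _ t₀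
  have hg : Function.Bijective g := by
    refine ⟨fun x y hxy => DFinsupp.ext fun t => ?_, fun v => ?_⟩
    · rw [huniq t]
      exact hxy
    · exact ⟨DirectSum.lof (BoundAlg I)ᵐᵒᵖ _ _ t₀ v, DirectSum.component.lof_self _ _ _⟩
  exact ⟨e.trans (LinearEquiv.ofBijective g hg).symm⟩

theorem mem_radPow_directSum {X : Type} [Finite X] [DecidableEq X] {N : X → Type u}
    [∀ t, AddCommGroup (N t)] [∀ t, Module (BoundAlg I)ᵐᵒᵖ (N t)] {n : ℕ} {y : ⨁ t, N t}
    (hy : ∀ t, y t ∈ radPow I (N t) n) : y ∈ radPow I (⨁ t, N t) n := by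
  have := Fintype.ofFinite X
  rw [← DirectSum.sum_univ_of y]
  exact AddSubgroup.sum_mem _ fun t _ =>
    map_mem_radPow (DirectSum.lof (BoundAlg I)ᵐᵒᵖ X N t) (hy t)

/-- The terms of a minimal projective resolution of a string module. -/
theorem nonempty_equiv_of_isMinimalProjectiveResolution (hI : IsStringPresentation I)
    {p : QPath V} (hp : IsNonzeroPath I p) (hs : IsRightMaximalSequence I p s)
    (P : ProjectiveResolution (ModuleCat.of (BoundAlg I)ᵐᵒᵖ (PathModule hI.monomial hp)))
    (hP : IsMinimalProjectiveResolution P) (n : ℕ) :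
    Nonempty (P.complex.X n ≃ₗ[(BoundAlg I)ᵐᵒᵖ]
      ⨁ t : ExistingTuples s (n + 1), ProjAt I t.path.src) := by
  obtain ⟨hs0, hnone, hstep⟩ := isRightMaximalSequence_iff.mp hs
  have hlike := hI.isStringLike
  have hunit : ∀ q : QPath V, (nil q.src).length = 0 ∧ comp? (nil q.src) q = some q :=
    fun q => ⟨rfl, nil_comp? q⟩
  have hN := hlike.nonzero_of_sequence hunit hp hs0 hnone hstep
  have hbranch : ∀ (n : ℕ) (t : ExistingTuples s (n + 1)), ∃ a, IsBranching comp?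
      (IsNonzeroPath I) (nil t.path.src) t.path (fun i => s (t.1 ++ [i])) a := fun n t =>
    hlike.exists_isBranching (hunit _).1 (hunit _).2 (hstep _ _ t.eq_some)
  choose a ha using hbranch
  obtain ⟨e⟩ := nonempty_stringSum_one_equiv hI.monomial hN hp hs0
  have hproj : ∀ n, Module.Projective (BoundAlg I)ᵐᵒᵖ (P.complex.X n) := fun n =>
    (IsProjective.iff_projective _).mpr (P.projective n)
  let π₀ : P.complex.X 0 →ₗ[(BoundAlg I)ᵐᵒᵖ] PathModule hI.monomial hp := (P.π.f 0).hom
  have hπ₀ : Function.Surjective π₀ := (ModuleCat.epi_iff_surjective (P.π.f 0)).mp inferInstance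
  let K : ∀ n, Submodule (BoundAlg I)ᵐᵒᵖ (P.complex.X n) := fun n =>
    match n with
    | 0 => LinearMap.ker π₀
    | n + 1 => LinearMap.ker (P.complex.d (n + 1) n).hom
  let ρ : ∀ n, (⨁ t : ExistingTuples s (n + 1), ProjAt I t.path.src) →ₗ[(BoundAlg I)ᵐᵒᵖ]
      StringSum hI.monomial hN (n + 1) := fun n =>
    DirectSum.lmap fun t => projCover hI.monomial (hN _ _ t.eq_some)
  let κ : ∀ n, StringSum hI.monomial hN (n + 1 + 1) →ₗ[(BoundAlg I)ᵐᵒᵖ]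
      ⨁ t : ExistingTuples s (n + 1), ProjAt I t.path.src := fun n =>
    (DirectSum.lmap fun t =>
      kernelInclusion hI.monomial (ha n t) fun i => hN _ _ i.eq_some) ∘ₗ
      (stringSumEquiv hI.monomial hN hnone (Nat.succ_pos n)).toLinearMap
  refine nonempty_equiv_of_projectiveCovers (P := fun n => P.complex.X n)
    (T := fun n => StringSum hI.monomial hN (n + 1))
    (S := fun n => ⨁ t : ExistingTuples s (n + 1), ProjAt I t.path.src)
    (d := fun n => (P.complex.d (n + 1) n).hom) (π := e.toLinearMap ∘ₗ π₀) (K := K) (ρ := ρ)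
    (ι := κ) (e.surjective.comp hπ₀) ?_ (fun _ => rfl) (fun n => ?_) (fun n => ?_) (fun n => ?_)
    (fun n => ?_) (fun n => ?_) (fun n => ?_) n
  · exact LinearMap.ker_comp_of_ker_eq_bot _ e.ker
  · cases n with
    | zero => exact (ShortComplex.moduleCat_exact_iff_range_eq_ker _).mp P.exact₀
    | succ n => exact (ShortComplex.moduleCat_exact_iff_range_eq_ker _).mp (P.exact_succ n)
  · cases n with
    | zero => exact hP.1
    | succ n => exact hP.2 n
  · exact (DirectSum.lmap_surjective _).mpr fun t => projCover_surjective _ _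
  · refine isSuperfluous_of_le_radPow hI fun y hy => mem_radPow_directSum fun t => ?_
    refine ker_projCover_le_radPow hI.monomial (hN _ _ t.eq_some) ?_
    exact DFunLike.congr_fun hy t
  · exact ((DirectSum.lmap_injective _).mpr fun t => kernelInclusion_injective _ _ _).comp
      (LinearEquiv.injective _)
  · rw [LinearMap.range_comp_of_range_eq_top _ (LinearEquiv.range _), DirectSum.range_lmap,
      DirectSum.ker_lmap]
    congr 2
    exact funext fun t => range_kernelInclusion hI.monomial (hN _ _ t.eq_some) _ _

/-- The terms of a minimal injective coresolution of a string module. -/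
theorem nonempty_equiv_of_isMinimalInjectiveResolution (hI : IsStringPresentation I)
    {p : QPath V} (hp : IsNonzeroPath I p) (hs : IsLeftMaximalSequence I p s)
    (J : InjectiveResolution (ModuleCat.of (BoundAlg I)ᵐᵒᵖ (PathModule hI.monomial hp)))
    (hJ : IsMinimalInjectiveResolution J) (n : ℕ) :
    Nonempty (J.cocomplex.X n ≃ₗ[(BoundAlg I)ᵐᵒᵖ]
      ⨁ t : ExistingTuples s (n + 1), InjAt I t.path.tgt) := by
  obtain ⟨hs0, hnone, hstep⟩ := isLeftMaximalSequence_iff.mp hs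
  have hlike := hI.isStringLike_flip
  have hunit : ∀ q : QPath V, (nil q.tgt).length = 0 ∧ flip comp? (nil q.tgt) q = some q :=
    fun q => ⟨rfl, comp?_nil q⟩
  have hN := hlike.nonzero_of_sequence hunit hp hs0 hnone hstep
  have hbranch : ∀ (n : ℕ) (t : ExistingTuples s (n + 1)), ∃ a, IsBranching (flip comp?)
      (IsNonzeroPath I) (nil t.path.tgt) t.path (fun i => s (t.1 ++ [i])) a := fun n t =>
    hlike.exists_isBranching (hunit _).1 (hunit _).2 (hstep _ _ t.eq_some)
  choose a ha using hbranch
  obtain ⟨e⟩ := nonempty_stringSum_one_equiv hI.monomial hN hp hs0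
  have hinj : ∀ n, Module.Injective (BoundAlg I)ᵐᵒᵖ (J.cocomplex.X n) := fun n =>
    (Module.injective_iff_injective_object _ _).mpr (J.injective n)
  have hinj' : ∀ n, Module.Injective (BoundAlg I)ᵐᵒᵖ
      (⨁ t : ExistingTuples s (n + 1), InjAt I t.path.tgt) := fun n => injective_directSum _
  let i₀ : PathModule hI.monomial hp →ₗ[(BoundAlg I)ᵐᵒᵖ] J.cocomplex.X 0 := (J.ι.f 0).hom
  have hi₀ : Function.Injective i₀ := (ModuleCat.mono_iff_injective (J.ι.f 0)).mp inferInstance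
  let K : ∀ n, Submodule (BoundAlg I)ᵐᵒᵖ (J.cocomplex.X n) := fun n =>
    match n with
    | 0 => LinearMap.range i₀
    | n + 1 => LinearMap.range (J.cocomplex.d n (n + 1)).hom
  let ι : ∀ n, StringSum hI.monomial hN (n + 1) →ₗ[(BoundAlg I)ᵐᵒᵖ]
      ⨁ t : ExistingTuples s (n + 1), InjAt I t.path.tgt := fun n =>
    DirectSum.lmap fun t => injEnvelope hI.monomial (hN _ _ t.eq_some)
  let ρ : ∀ n, (⨁ t : ExistingTuples s (n + 1), InjAt I t.path.tgt) →ₗ[(BoundAlg I)ᵐᵒᵖ]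
      StringSum hI.monomial hN (n + 1 + 1) := fun n =>
    (stringSumEquiv hI.monomial hN hnone (Nat.succ_pos n)).symm.toLinearMap ∘ₗ
      DirectSum.lmap fun t =>
        cokernelProjection hI.monomial (ha n t) fun i => hN _ _ i.eq_some
  refine nonempty_equiv_of_injectiveEnvelopes (J := fun n => J.cocomplex.X n)
    (T := fun n => StringSum hI.monomial hN (n + 1))
    (S := fun n => ⨁ t : ExistingTuples s (n + 1), InjAt I t.path.tgt)
    (d := fun n => (J.cocomplex.d n (n + 1)).hom) (i := i₀ ∘ₗ e.symm.toLinearMap) (K := K)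
    (ι := ι) (ρ := ρ) (hi₀.comp e.symm.injective) ?_ (fun _ => rfl) (fun n => ?_) (fun n => ?_)
    (fun n => ?_) (fun n => ?_) (fun n => ?_) (fun n => ?_) n
  · exact LinearMap.range_comp_of_range_eq_top _ e.symm.range
  · cases n with
    | zero => exact ((ShortComplex.moduleCat_exact_iff_range_eq_ker _).mp J.exact₀).symm
    | succ n => exact ((ShortComplex.moduleCat_exact_iff_range_eq_ker _).mp (J.exact_succ n)).symm
  · cases n with
    | zero => exact hJ.1
    | succ n => exact hJ.2 n
  · exact (DirectSum.lmap_injective _).mpr fun t => injEnvelope_injective _ _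
  · refine isEssential_of_socle_le hI fun y hy => ?_
    rw [DirectSum.range_lmap]
    intro t _
    refine mem_range_injEnvelope_of_socle hI.monomial (hN _ _ t.eq_some) fun α hα => ?_
    exact DFunLike.congr_fun (hy α hα) t
  · exact (stringSumEquiv hI.monomial hN hnone (Nat.succ_pos n)).symm.surjective.comp
      ((DirectSum.lmap_surjective _).mpr fun t => cokernelProjection_surjective _ _ _)
  · rw [LinearMap.ker_comp_of_ker_eq_bot _ (LinearEquiv.ker _), DirectSum.range_lmap,
      DirectSum.ker_lmap]
    congr 2
    exact funext fun t => range_injEnvelope_eq_ker hI.monomial (hN _ _ t.eq_some) _ _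

end Resolutions

end StringAlg

end

theorem theorem3p3 {k V : Type u} [Field k] [Quiver.{u} V] [Fintype V]
    (I : TwoSidedIdeal (PathAlgebra k V)) (hI : IsStringPresentation I) :
    (∀ (p : QPath V) (hp : IsNonzeroPath I p),
      (∃ s, IsRightMaximalSequence I p s) ∧
      ∀ s, IsRightMaximalSequence I p s →
        ∀ P : ProjectiveResolution (ModuleCat.of (BoundAlg I)ᵐᵒᵖ (PathModule hI.monomial hp)),
          IsMinimalProjectiveResolution P →
            ∀ l : ℕ, 1 ≤ l →
              Nonempty (P.complex.X (l - 1) ≃ₗ[(BoundAlg I)ᵐᵒᵖ]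
                ⨁ t : ExistingTuples s l, ProjAt I t.path.src)) ∧
    (∀ (p : QPath V) (hp : IsNonzeroPath I p),
      (∃ s, IsLeftMaximalSequence I p s) ∧
      ∀ s, IsLeftMaximalSequence I p s →
        ∀ J : InjectiveResolution (ModuleCat.of (BoundAlg I)ᵐᵒᵖ (PathModule hI.monomial hp)),
          IsMinimalInjectiveResolution J →
            ∀ l : ℕ, 1 ≤ l →
              Nonempty (J.cocomplex.X (l - 1) ≃ₗ[(BoundAlg I)ᵐᵒᵖ]
                ⨁ t : ExistingTuples s l, InjAt I t.path.tgt)) := by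
  refine ⟨fun p hp => ⟨?_, fun s hs P hP l hl => ?_⟩, fun p hp => ⟨?_, fun s hs J hJ l hl => ?_⟩⟩
  · obtain ⟨s, hs⟩ := hI.isStringLike.exists_sequence (e := fun q => QPath.nil q.src)
      (fun q => ⟨rfl, QPath.nil_comp? q⟩) hp
    exact ⟨s, isRightMaximalSequence_iff.mpr hs⟩
  · obtain ⟨n, rfl⟩ := Nat.exists_eq_add_of_le' hl
    exact nonempty_equiv_of_isMinimalProjectiveResolution hI hp hs P hP n
  · obtain ⟨s, hs⟩ := hI.isStringLike_flip.exists_sequence (e := fun q => QPath.nil q.tgt)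
      (fun q => ⟨rfl, QPath.comp?_nil q⟩) hp
    exact ⟨s, isLeftMaximalSequence_iff.mpr hs⟩
  · obtain ⟨n, rfl⟩ := Nat.exists_eq_add_of_le' hl
    exact nonempty_equiv_of_isMinimalInjectiveResolution hI hp hs J hJ n
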